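/- Let $a\in(0,1/14)$ and put $\sigma_n=n^{-a}$ for every integer $n\ge 1$. Let $(\Omega,\mathcal F,\mathbb P)$ be a probability space and let $X_1,X_2,\dots$ be independent random variables on it with $\mathbb P(X_n=1)=\sigma_n$ and $\mathbb P(X_n=0)=1-\sigma_n$. For $n\ge 1$ let $a_n(\omega)$ be the smallest positive integer $k$ such that $X_1(\omega)+\dots+X_k(\omega)=n$ (almost surely such a $k$ exists for every $n$); that is, $(a_n(\omega))_{n\ge1}$ lists in increasing order the positive integers $m$ with $X_m(\omega)=1$. For $E\subset\mathbb Z^2$ write $$\bar d(E)=\limsup_{N\to\infty}\frac{|E\cap[-N,N]^2|}{|[-N,N]^2|},$$ where $[-N,N]^2$ denotes the set of lattice points $(x,y)\in\mathbb Z^2$ with $|x|,|y|\le N$, and write $E-w=\{e-w : e\in E\}$ for $w\in\mathbb Z^2$. Then for almost every $\omega\in\Omega$ the following holds: for all $\mathbf v_1,\mathbf v_2\in\mathbb Z^2$ and every $E\subset\mathbb Z^2$, $$\liminf_{N\to\infty}\frac1N\sum_{n=1}^N \bar d\bigl(E\cap(E-n\mathbf v_1)\cap(E-a_n(\omega)\mathbf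 v_2)\bigr)\ \ge\ \bigl(\bar d(E)\bigr)^3.$$ -/

import Mathlib

open MeasureTheory ProbabilityTheory Filter

/-- The lattice square `[-N, N]²` in `ℤ²`. -/
def latticeBox (N : ℕ) : Set (ℤ × ℤ) :=
  Set.Icc (-(N : ℤ), -(N : ℤ)) ((N : ℤ), (N : ℤ))

/-- The upper density `limsup_{N → ∞} |E ∩ [-N, N]²| / |[-N, N]²|` of a set `E ⊆ ℤ²`.
The quotients lie in `[0, 1]`, so this real `limsup` is the usual one. -/
noncomputable def upperDensity (E : Set (ℤ × ℤ)) : ℝ :=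
  limsup (fun N : ℕ => ((E ∩ latticeBox N).ncard : ℝ) / ((latticeBox N).ncard : ℝ)) atTop

/-- The translate `E - w = {e - w : e ∈ E}`, written as `{x : x + w ∈ E}`. -/
def translateSub (E : Set (ℤ × ℤ)) (w : ℤ × ℤ) : Set (ℤ × ℤ) :=
  {x | x + w ∈ E}

/-- For a sequence `x₁, x₂, …` (the value at index `0` is ignored), the smallest `k` such that
`x₁ + ⋯ + x_k = n`. For `n ≥ 1` and a sequence of zeros and ones with at least `n` ones, this is
the `n`-th index (in increasing order) at which the sequence equals `1`. -/
noncomputable def selectedIndex (x : ℕ → ℝ) (n : ℕ) : ℕ :=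
  sInf {k : ℕ | ∑ j ∈ Finset.Icc 1 k, x j = (n : ℝ)}

/-! Write `x k ∈ {0, 1}` for the selections (indexed from `0`), `p k` for their means, `y k` for the
number of selections before `k`, and `W N = ∑_{k<N} p k`. Reindexing by the selected positions turns
the first `N` terms of the average into `∑_{k<M} x k * F (y k + 1) (k + 1)`, where `y M = N`. The
correspondence principle `exists_mean_eq_upperDensity` bounds `F` below by `m (f * shift f * shift
f)`, where `f` is the indicator of `E` and `m` is an invariant mean with `m f = upperDensity E`.

The core is that `x k` may be replaced by `p k` with error `o(W N)`. With `z = x - p`, two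
applications of van der Corput's inequality bound the sum of `z k * m (h * (shift (y k • v₁) f *
shift (k • v₂) g))`. The first, with Cauchy-Schwarz, discards `g`; after the second, the functions
enter only through the increments of `y`. Grouping by increments leaves fourfold correlations of `z`
that involve neither the functions, nor the directions, nor the mean
(`InvariantMean.sq_sum_le_doubleCorputBound`). Hence one null set serves for all `E`, `v₁`, `v₂`.
The factor with the largest index is centered and independent of the others and of the increment
conditions, so these correlations are sums of martingale differences and have small second moment
(`integral_sum_incrementCorrelation_sq_le`). Optimizing the parameters requires `a < 1/14`.
Borel-Cantelli along a polynomial sequence and interpolation give the almost sure statement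
(`ae_isRegularSelection`, `tendsto_centered_correlation`).

In the sum weighted by `p k`, the count `y` is constant over most short stretches, so the second
function may be averaged along `v₂`. By the mean ergodic theorem its average is almost invariant,
and the dependence on `k` through `v₂` disappears. Passing back from `p k` to `x k` yields an
ordinary ergodic average along `v₁`. The limit is thus `m (f * A * B)`, with `A`, `B` long averages
of `f` along `v₁`, `v₂`. Finally `m (f * A * B) ≥ (m f) ^ 3` up to a small error (`cube_sub_le`), by
the inequality `x * y + 1/x + 1/y ≥ 3` and the fact that `f / A` has mean at most `1`. -/

open scoped BoundedContinuousFunction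

/-! ### Invariant means and their seminorm -/

section Means

variable {G : Type*} [AddCommGroup G] [TopologicalSpace G] [DiscreteTopology G]

/-- The translate `x ↦ f (x + w)` of a bounded function. -/
def shift (w : G) (f : G →ᵇ ℝ) : G →ᵇ ℝ :=
  f.compContinuous ⟨fun x => x + w, continuous_of_discreteTopology⟩

@[simp] lemma shift_apply (w : G) (f : G →ᵇ ℝ) (x : G) : shift w f x = f (x + w) := rfl

lemma shift_mul (w : G) (f g : G →ᵇ ℝ) : shift w (f * g) = shift w f * shift w g := rfl

lemma shift_shift (w w' : G) (f : G →ᵇ ℝ) : shift w (shift w' f) = shift (w + w') f := by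
  ext x; simp [add_assoc]

@[simp] lemma shift_zero (f : G →ᵇ ℝ) : shift 0 f = f := by
  ext x; simp

lemma shift_smul (w : G) (c : ℝ) (f : G →ᵇ ℝ) : shift w (c • f) = c • shift w f := rfl

lemma shift_sum {ι : Type*} (w : G) (s : Finset ι) (f : ι → G →ᵇ ℝ) :
    shift w (∑ i ∈ s, f i) = ∑ i ∈ s, shift w (f i) := by
  ext x; simp

/-- A shift-invariant mean on the bounded functions on `G`. -/
structure InvariantMean (G : Type*) [AddCommGroup G] [TopologicalSpace G]
    [DiscreteTopology G] where
  toLin : (G →ᵇ ℝ) →ₗ[ℝ] ℝ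
  nonneg : ∀ f, (∀ x, 0 ≤ f x) → 0 ≤ toLin f
  map_one : toLin 1 = 1
  invariant : ∀ w f, toLin (shift w f) = toLin f

instance : CoeFun (InvariantMean G) (fun _ => (G →ᵇ ℝ) → ℝ) := ⟨fun m => m.toLin⟩

namespace InvariantMean

variable (m : InvariantMean G)

lemma mono {f g : G →ᵇ ℝ} (h : ∀ x, f x ≤ g x) : m f ≤ m g := by
  have := m.nonneg (g - f) (fun x => by simpa using h x)
  rw [map_sub] at this
  linarith

lemma apply_smul_one (c : ℝ) : m (c • (1 : G →ᵇ ℝ)) = c := by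
  rw [map_smul, m.map_one, smul_eq_mul, mul_one]

lemma le_of_le {f : G →ᵇ ℝ} {c : ℝ} (h : ∀ x, f x ≤ c) : m f ≤ c := by
  have := m.mono (f := f) (g := c • (1 : G →ᵇ ℝ)) (fun x => by simpa using h x)
  rwa [m.apply_smul_one] at this

lemma abs_le_of_abs_le {f : G →ᵇ ℝ} {c : ℝ} (h : ∀ x, |f x| ≤ c) : |m f| ≤ c := by
  have h1 : m f ≤ c := m.le_of_le fun x => (abs_le.1 (h x)).2
  have h2 : m (-f) ≤ c := m.le_of_le fun x => by
    have := (abs_le.1 (h x)).1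
    simp only [BoundedContinuousFunction.coe_neg, Pi.neg_apply]; linarith
  rw [map_neg] at h2
  exact abs_le.2 ⟨by linarith, h1⟩

lemma sq_nonneg (f : G →ᵇ ℝ) : 0 ≤ m (f * f) :=
  m.nonneg _ fun x => by simpa using mul_self_nonneg (f x)

lemma mul_sq_le (f g : G →ᵇ ℝ) : m (f * g) ^ 2 ≤ m (f * f) * m (g * g) := by
  -- The quadratic `m ((f + t g)²)` in `t` is nonnegative, so its discriminant is nonpositive.
  have key : ∀ t : ℝ, 0 ≤ m (g * g) * (t * t) + 2 * m (f * g) * t + m (f * f) := by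
    intro t
    have h := m.sq_nonneg (f + t • g)
    have e : (f + t • g) * (f + t • g) = f * f + (2 * t) • (f * g) + (t * t) • (g * g) := by
      ext x; simp; ring
    rw [e, map_add, map_add, map_smul, map_smul, smul_eq_mul, smul_eq_mul] at h
    linarith
  have := discrim_le_zero key
  unfold discrim at this
  linarith

lemma abs_mul_le_sqrt {f g : G →ᵇ ℝ} (hg : ∀ x, |g x| ≤ 1) : |m (g * f)| ≤ √(m (f * f)) := by
  apply Real.abs_le_sqrt
  have h1 : m (g * g) ≤ 1 := m.le_of_le fun x => by
    simpa [← pow_two] using hg x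
  nlinarith [m.mul_sq_le g f, m.sq_nonneg f]

lemma sq_sum_le {ι : Type*} (s : Finset ι) (t : ι → G →ᵇ ℝ) :
    m ((∑ k ∈ s, t k) * ∑ k ∈ s, t k) ≤ s.card * ∑ k ∈ s, m (t k * t k) := by
  have h := m.mono (f := (∑ k ∈ s, t k) * ∑ k ∈ s, t k)
    (g := (s.card : ℝ) • ∑ k ∈ s, t k * t k) (fun x => by
      simpa [← pow_two] using sq_sum_le_card_mul_sum_sq (s := s) (f := fun k => t k x))
  rwa [map_smul, map_sum, smul_eq_mul] at h

end InvariantMean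

end Means

/-! ### Van der Corput inequalities -/

/-- Any `D ≥ N` is allowed since the inner range is empty for `d ≥ N`; the freedom lets the range of
`d` also contain all shifts below `R` when `R > N`. -/
lemma sum_triangle_eq_sum_diff (N D : ℕ) (hD : N ≤ D) (a : ℕ → ℕ → ℝ) :
    ∑ x ∈ (Finset.range N ×ˢ Finset.range N) with x.1 < x.2, a x.1 x.2 =
      ∑ d ∈ Finset.Ico 1 D, ∑ n ∈ Finset.range (N - d), a n (n + d) := by
  rw [Finset.sum_sigma']
  refine Finset.sum_bij' (fun x _ => ⟨x.2 - x.1, x.1⟩) (fun x _ => (x.2, x.2 + x.1)) ?_ ?_ ?_ ?_ ?_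
  · rintro ⟨i, j⟩ h
    simp only [Finset.mem_filter, Finset.mem_product, Finset.mem_range, Finset.mem_sigma,
      Finset.mem_Ico] at h ⊢
    omega
  · rintro ⟨i, j⟩ h
    simp only [Finset.mem_filter, Finset.mem_product, Finset.mem_range, Finset.mem_sigma,
      Finset.mem_Ico] at h ⊢
    omega
  · rintro ⟨i, j⟩ h
    simp only [Finset.mem_filter, Finset.mem_product, Finset.mem_range] at h
    simp only [Prod.mk.injEq, true_and]
    omega
  · rintro ⟨i, j⟩ h
    simp
  · rintro ⟨i, j⟩ h
    simp only [Finset.mem_filter, Finset.mem_product, Finset.mem_range] at h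
    simp only
    rw [Nat.add_sub_cancel' h.2.le]

lemma sum_square_eq_of_symm (N D : ℕ) (hD : N ≤ D) (a : ℕ → ℕ → ℝ) (ha : ∀ i j, a i j = a j i) :
    ∑ i ∈ Finset.range N, ∑ j ∈ Finset.range N, a i j =
      ∑ i ∈ Finset.range N, a i i +
        2 * ∑ d ∈ Finset.Ico 1 D, ∑ n ∈ Finset.range (N - d), a n (n + d) := by
  rw [← sum_triangle_eq_sum_diff N D hD]
  induction N with
  | zero => simp
  | succ N ih =>
    have hT : ∑ x ∈ (Finset.range (N + 1) ×ˢ Finset.range (N + 1)) with x.1 < x.2, a x.1 x.2 =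
        ∑ x ∈ (Finset.range N ×ˢ Finset.range N) with x.1 < x.2, a x.1 x.2 +
          ∑ i ∈ Finset.range N, a i N := by
      simp only [Finset.sum_filter, Finset.sum_product, Finset.sum_range_succ]
      rw [Finset.sum_add_distrib]
      have h1 : ∑ x ∈ Finset.range N, (if N < x then a N x else 0) = 0 :=
        Finset.sum_eq_zero fun x hx => if_neg (by have := Finset.mem_range.1 hx; omega)
      have h2 : ∑ x ∈ Finset.range N, (if x < N then a x N else 0) =
          ∑ x ∈ Finset.range N, a x N :=
        Finset.sum_congr rfl fun x hx => if_pos (Finset.mem_range.1 hx)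
      rw [h1, h2]; simp
    rw [hT]
    simp only [Finset.sum_range_succ, Finset.sum_add_distrib]
    rw [ih (by omega), Finset.sum_congr rfl fun i _ => ha N i]
    ring

/-- Van der Corput's inequality for finite real sequences. -/
lemma van_der_corput_real (u : ℕ → ℝ) (N R : ℕ) :
    (R : ℝ) ^ 2 * (∑ n ∈ Finset.range N, u n) ^ 2 ≤
      ((N : ℝ) + R) * ((R : ℝ) * ∑ n ∈ Finset.range N, u n ^ 2 +
        2 * ∑ d ∈ Finset.Ico 1 R, ((R : ℝ) - d) *
          ∑ n ∈ Finset.range (N - d), u n * u (n + d)) := by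
  -- `t k` is the sum of `u` over the window of `R` indices ending at `k`. Each `n < N` lies in
  -- exactly `R` of the `N + R` windows.
  set t : ℕ → ℝ := fun k => ∑ n ∈ Finset.range N, if n ≤ k ∧ k < n + R then u n else 0 with ht
  have hsum : ∑ k ∈ Finset.range (N + R), t k = R * ∑ n ∈ Finset.range N, u n := by
    rw [ht, Finset.sum_comm, Finset.mul_sum]
    refine Finset.sum_congr rfl fun n hn => ?_
    rw [← Finset.sum_filter, Finset.sum_const, nsmul_eq_mul]
    congr 2
    have : (Finset.range (N + R)).filter (fun k => n ≤ k ∧ k < n + R) = Finset.Ico n (n + R) := by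
      ext k; simp only [Finset.mem_filter, Finset.mem_range, Finset.mem_Ico] at hn ⊢; omega
    rw [this]; simp
  -- The number of windows containing both `i` and `j` is `R - |i - j|`, truncated at `0`; this is
  -- why only shifts `d < R` survive.
  have hsq : ∑ k ∈ Finset.range (N + R), t k ^ 2 =
      ∑ i ∈ Finset.range N, ∑ j ∈ Finset.range N,
        ((R - (max i j - min i j) : ℕ) : ℝ) * (u i * u j) := by
    have e : ∀ k, t k ^ 2 = ∑ i ∈ Finset.range N, ∑ j ∈ Finset.range N,
        if (i ≤ k ∧ k < i + R) ∧ (j ≤ k ∧ k < j + R) then u i * u j else 0 := by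
      intro k
      rw [pow_two, ht, Finset.sum_mul_sum]
      refine Finset.sum_congr rfl fun i _ => Finset.sum_congr rfl fun j _ => ?_
      split_ifs <;> simp_all
    simp only [e]
    rw [Finset.sum_comm]
    refine Finset.sum_congr rfl fun i hi => ?_
    rw [Finset.sum_comm]
    refine Finset.sum_congr rfl fun j hj => ?_
    rw [← Finset.sum_filter, Finset.sum_const, nsmul_eq_mul]
    congr 2
    have : (Finset.range (N + R)).filter
        (fun k => (i ≤ k ∧ k < i + R) ∧ (j ≤ k ∧ k < j + R)) =
        Finset.Ico (max i j) (min i j + R) := by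
      ext k; simp only [Finset.mem_filter, Finset.mem_range, Finset.mem_Ico] at hi hj ⊢; omega
    rw [this, Nat.card_Ico]; omega
  have hcs := sq_sum_le_card_mul_sum_sq (s := Finset.range (N + R)) (f := t)
  rw [hsum, hsq, Finset.card_range, mul_pow, sum_square_eq_of_symm N (N + R) (by omega) _
    (fun i j => by rw [max_comm, min_comm, mul_comm (u i)])] at hcs
  refine hcs.trans_eq ?_
  push_cast
  congr 2
  · rw [Finset.mul_sum]
    exact Finset.sum_congr rfl fun i _ => by simp [pow_two]
  · congr 1
    have hsub : Finset.Ico 1 R ⊆ Finset.Ico 1 (N + R) := Finset.Ico_subset_Ico_right (by omega)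
    rw [← Finset.sum_subset hsub]
    · refine Finset.sum_congr rfl fun d hd => ?_
      rw [Finset.mul_sum]
      refine Finset.sum_congr rfl fun n _ => ?_
      have := (Finset.mem_Ico.1 hd).2
      have e : R - (max n (n + d) - min n (n + d)) = R - d := by omega
      rw [e, Nat.cast_sub this.le]
    · intro d hd hd'
      refine Finset.sum_eq_zero fun n _ => ?_
      simp only [Finset.mem_Ico] at hd hd'
      have e : R - (max n (n + d) - min n (n + d)) = 0 := by omega
      rw [e]; simp

section Means

variable {G : Type*} [AddCommGroup G] [TopologicalSpace G] [DiscreteTopology G]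

/-- Van der Corput's inequality for the seminorm of an invariant mean. -/
lemma InvariantMean.van_der_corput (m : InvariantMean G) (u : ℕ → G →ᵇ ℝ) (N R : ℕ) (hR : 0 < R) :
    m ((∑ n ∈ Finset.range N, u n) * ∑ n ∈ Finset.range N, u n) ≤
      ((N : ℝ) + R) / R * (∑ n ∈ Finset.range N, m (u n * u n) +
        2 * ∑ d ∈ Finset.Ico 1 R, |∑ n ∈ Finset.range (N - d), m (u n * u (n + d))|) := by
  have hR' : (0 : ℝ) < R := by exact_mod_cast hR
  have h := m.mono
    (f := ((R : ℝ) ^ 2) • ((∑ n ∈ Finset.range N, u n) * ∑ n ∈ Finset.range N, u n))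
    (g := ((N : ℝ) + R) • ((R : ℝ) • ∑ n ∈ Finset.range N, u n * u n +
        (2 : ℝ) • ∑ d ∈ Finset.Ico 1 R, ((R : ℝ) - d) •
          ∑ n ∈ Finset.range (N - d), u n * u (n + d))) (fun x => by
      simpa [← pow_two, mul_add] using van_der_corput_real (fun n => u n x) N R)
  simp only [map_smul, map_add, map_sum, smul_eq_mul] at h
  have h2 : ∑ d ∈ Finset.Ico 1 R, ((R : ℝ) - d) *
      ∑ n ∈ Finset.range (N - d), m (u n * u (n + d)) ≤
      ∑ d ∈ Finset.Ico 1 R, (R : ℝ) * |∑ n ∈ Finset.range (N - d), m (u n * u (n + d))| := by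
    refine Finset.sum_le_sum fun d hd => ?_
    have hd' : (d : ℝ) ≤ R := by exact_mod_cast (Finset.mem_Ico.1 hd).2.le
    have hd0 : (0 : ℝ) ≤ d := Nat.cast_nonneg d
    refine (mul_le_mul_of_nonneg_left (le_abs_self _) (by linarith)).trans ?_
    exact mul_le_mul_of_nonneg_right (by linarith) (abs_nonneg _)
  rw [← Finset.mul_sum] at h2
  have h3 : (R : ℝ) ^ 2 * m ((∑ n ∈ Finset.range N, u n) * ∑ n ∈ Finset.range N, u n) ≤
      ((N : ℝ) + R) * (R * (∑ n ∈ Finset.range N, m (u n * u n) +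
        2 * ∑ d ∈ Finset.Ico 1 R, |∑ n ∈ Finset.range (N - d), m (u n * u (n + d))|)) := by
    refine h.trans (mul_le_mul_of_nonneg_left ?_ (by positivity))
    linarith
  rw [div_mul_eq_mul_div, le_div_iff₀ hR']
  have : (R : ℝ) * (m ((∑ n ∈ Finset.range N, u n) * ∑ n ∈ Finset.range N, u n) * R) ≤
    R * (((N : ℝ) + R) * (∑ n ∈ Finset.range N, m (u n * u n) +
        2 * ∑ d ∈ Finset.Ico 1 R, |∑ n ∈ Finset.range (N - d), m (u n * u (n + d))|)) := by
    linarith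
  exact le_of_mul_le_mul_left this hR'

/-! ### Two applications of van der Corput's inequality -/

/-- Fourfold correlation of the weights `z` over the indices `n` at which the increments of the
counting function `y` take prescribed values. -/
def incrementCorrelation (z : ℕ → ℝ) (y : ℕ → ℕ) (N r s : ℕ) (i : ℕ × ℕ × ℕ) : ℝ :=
  ∑ n ∈ Finset.range (N - r - s), z n * z (n + r) * z (n + s) * z (n + s + r) *
    if y (n + r) = y n + i.1 ∧ y (n + s) = y n + i.2.1 ∧ y (n + s + r) = y (n + s) + i.2.2
      then 1 else 0

/-- The triples of increments that can occur for shifts below `R`, `S` and `R`. -/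
def incrementBox (R S : ℕ) : Finset (ℕ × ℕ × ℕ) :=
  Finset.range R ×ˢ Finset.range S ×ˢ Finset.range R

/-- The bound obtained from two applications of van der Corput's inequality. -/
noncomputable def doubleCorputBound (z : ℕ → ℝ) (y : ℕ → ℕ) (N R S : ℕ) (l : ℝ) : ℝ :=
  ((N : ℝ) + R) / R * (∑ n ∈ Finset.range N, z n ^ 2 +
    ∑ r ∈ Finset.Ico 1 R, (l + l⁻¹ * (((N : ℝ) + S) / S * (∑ n ∈ Finset.range N, z n ^ 2 +
      2 * ∑ s ∈ Finset.Ico 1 S, ∑ i ∈ incrementBox R S, |incrementCorrelation z y N r s i|))))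

lemma increment_le {y : ℕ → ℕ} (hy : ∀ n, y n ≤ y (n + 1) ∧ y (n + 1) ≤ y n + 1) (n r : ℕ) :
    y n ≤ y (n + r) ∧ y (n + r) ≤ y n + r := by
  induction r with
  | zero => simp
  | succ r ih => have := hy (n + r); rw [← add_assoc]; omega

/-- Replaces a square root by an expression linear in the square, so that expectations can later be
taken term by term; `l` is chosen at the end. -/
lemma two_mul_le_add_inv_mul_sq {x l : ℝ} (hl : 0 < l) : 2 * x ≤ l + l⁻¹ * x ^ 2 := by
  have : l + l⁻¹ * x ^ 2 - 2 * x = l⁻¹ * (l - x) ^ 2 := by field_simp; ring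
  have h2 : 0 ≤ l⁻¹ * (l - x) ^ 2 := by positivity
  linarith

lemma abs_mul_le_one {a b : ℝ} (ha : |a| ≤ 1) (hb : |b| ≤ 1) : |a * b| ≤ 1 := by
  rw [abs_mul]; exact mul_le_one₀ ha (abs_nonneg _) hb

/-- A factor depending only on the three increments is constant on each of the level sets of the
increments, and these are enumerated by the box because an increment over a shift `r` is at most
`r`. -/
lemma abs_sum_quadruple_le {z : ℕ → ℝ} {y : ℕ → ℕ}
    (hy : ∀ n, y n ≤ y (n + 1) ∧ y (n + 1) ≤ y n + 1) (psi : ℕ × ℕ × ℕ → ℝ)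
    (hpsi : ∀ i, |psi i| ≤ 1) {N R S r s : ℕ} (hr : r < R) (hs : s < S) :
    |∑ n ∈ Finset.range (N - r - s), z n * z (n + r) * z (n + s) * z (n + s + r) *
        psi (y (n + r) - y n, y (n + s) - y n, y (n + s + r) - y (n + s))| ≤
      ∑ i ∈ incrementBox R S, |incrementCorrelation z y N r s i| := by
  have e : ∑ n ∈ Finset.range (N - r - s), z n * z (n + r) * z (n + s) * z (n + s + r) *
        psi (y (n + r) - y n, y (n + s) - y n, y (n + s + r) - y (n + s)) =
      ∑ i ∈ incrementBox R S, psi i * incrementCorrelation z y N r s i := by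
    simp only [incrementCorrelation, Finset.mul_sum]
    rw [Finset.sum_comm]
    refine Finset.sum_congr rfl fun n _ => ?_
    have h1 := increment_le hy n r
    have h2 := increment_le hy n s
    have h3 := increment_le hy (n + s) r
    rw [Finset.sum_eq_single (y (n + r) - y n, y (n + s) - y n, y (n + s + r) - y (n + s))]
    · rw [if_pos (by simp only; omega)]; ring
    · rintro ⟨i, j, k⟩ _ hne
      rw [if_neg]
      · ring
      · simp only [ne_eq, Prod.mk.injEq] at hne ⊢
        omega
    · intro h
      exfalso; apply h
      simp only [incrementBox, Finset.mem_product, Finset.mem_range]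
      omega
  rw [e]
  refine (Finset.abs_sum_le_sum_abs _ _).trans (Finset.sum_le_sum fun i _ => ?_)
  rw [abs_mul]
  exact mul_le_of_le_one_left (abs_nonneg _) (hpsi i)

/-- The right side does not involve `m`, the functions or the directions: this uniformity makes the
exceptional null set independent of `E`, `v₁`, `v₂`. -/
lemma InvariantMean.sq_sum_le_doubleCorputBound (m : InvariantMean G) {z : ℕ → ℝ} {y : ℕ → ℕ}
    (hz : ∀ n, |z n| ≤ 1) (hy : ∀ n, y n ≤ y (n + 1) ∧ y (n + 1) ≤ y n + 1) (v₁ v₂ : G)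
    {f g h : G →ᵇ ℝ} (hf : ∀ x, |f x| ≤ 1) (hg : ∀ x, |g x| ≤ 1) (hh : ∀ x, |h x| ≤ 1)
    {N R S : ℕ} (hR : 0 < R) (hS : 0 < S) {l : ℝ} (hl : 0 < l) :
    (∑ n ∈ Finset.range N, z n * m (h * (shift (y n • v₁) f * shift (n • v₂) g))) ^ 2 ≤
      doubleCorputBound z y N R S l := by
  set u : ℕ → G →ᵇ ℝ := fun n => z n • (shift (y n • v₁) f * shift (n • v₂) g) with hu
  have h0 : (∑ n ∈ Finset.range N, z n * m (h * (shift (y n • v₁) f * shift (n • v₂) g))) ^ 2 ≤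
      m ((∑ n ∈ Finset.range N, u n) * ∑ n ∈ Finset.range N, u n) := by
    have e : ∑ n ∈ Finset.range N, z n * m (h * (shift (y n • v₁) f * shift (n • v₂) g)) =
        m (h * ∑ n ∈ Finset.range N, u n) := by
      rw [Finset.mul_sum, map_sum]
      refine Finset.sum_congr rfl fun n _ => ?_
      rw [hu, mul_smul_comm, map_smul, smul_eq_mul]
    rw [e]
    have h1 : m (h * h) ≤ 1 := m.le_of_le fun x => (le_abs_self _).trans (abs_mul_le_one (hh x) (hh x))
    nlinarith [m.mul_sq_le h (∑ n ∈ Finset.range N, u n), m.sq_nonneg (∑ n ∈ Finset.range N, u n)]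
  refine h0.trans ((m.van_der_corput u N R hR).trans ?_)
  unfold doubleCorputBound
  refine mul_le_mul_of_nonneg_left (add_le_add ?_ ?_) (by positivity)
  · refine Finset.sum_le_sum fun n _ => ?_
    have e : u n * u n = (z n ^ 2) • ((shift (y n • v₁) f * shift (n • v₂) g) *
        (shift (y n • v₁) f * shift (n • v₂) g)) := by
      simp only [hu, smul_mul_smul_comm, pow_two]
    rw [e, map_smul, smul_eq_mul]
    refine mul_le_of_le_one_right (by positivity) (m.le_of_le fun x => ?_)
    have := abs_mul_le_one (hf (x + y n • v₁)) (hg (x + n • v₂))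
    exact (le_abs_self _).trans (abs_mul_le_one this this)
  rw [Finset.mul_sum]
  refine Finset.sum_le_sum fun r hr => ?_
  have hr2 : r < R := (Finset.mem_Ico.1 hr).2
  set F : ℕ → G →ᵇ ℝ := fun d => f * shift (d • v₁) f with hF
  have hFb : ∀ d x, |F d x| ≤ 1 := fun d x => abs_mul_le_one (hf x) (hf _)
  set v : ℕ → G →ᵇ ℝ := fun n => (z n * z (n + r)) •
    shift (y n • v₁ - n • v₂) (F (y (n + r) - y n)) with hv
  -- Undoing the translation by `n • v₂` makes the factor in `g` independent of `n`. It then comes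
  -- out of the sum over `n` and Cauchy-Schwarz discards it, leaving only `v`.
  have hcorr : ∀ n, m (u n * u (n + r)) = m ((g * shift (r • v₂) g) * v n) := by
    intro n
    have hinc := increment_le hy n r
    rw [← m.invariant (n • v₂) (_ * v n)]
    congr 1
    ext x
    have e1 : x + n • v₂ + (y n • v₁ - n • v₂) = x + y n • v₁ := by abel
    have e2 : x + y n • v₁ + (y (n + r) - y n) • v₁ = x + y (n + r) • v₁ := by
      rw [add_assoc, ← add_smul, Nat.add_sub_cancel' hinc.1]
    simp only [hu, hv, hF, BoundedContinuousFunction.coe_mul, BoundedContinuousFunction.coe_smul,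
      Pi.mul_apply, shift_apply, smul_eq_mul, e1, e2]
    rw [add_assoc x (n • v₂) (r • v₂), ← add_smul]
    ring
  have hsumcorr : |∑ n ∈ Finset.range (N - r), m (u n * u (n + r))| ≤
      √(m ((∑ n ∈ Finset.range (N - r), v n) * ∑ n ∈ Finset.range (N - r), v n)) := by
    rw [Finset.sum_congr rfl fun n _ => hcorr n, ← map_sum, ← Finset.mul_sum]
    exact m.abs_mul_le_sqrt fun x => abs_mul_le_one (hg x) (hg _)
  refine (mul_le_mul_of_nonneg_left hsumcorr zero_le_two).trans
    ((two_mul_le_add_inv_mul_sq hl).trans ?_)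
  rw [Real.sq_sqrt (m.sq_nonneg _)]
  refine add_le_add le_rfl (mul_le_mul_of_nonneg_left ?_ (by positivity))
  refine (m.van_der_corput v (N - r) S hS).trans ?_
  have hfac : (((N - r : ℕ) : ℝ) + S) / S ≤ ((N : ℝ) + S) / S := by
    gcongr; exact_mod_cast Nat.sub_le N r
  refine mul_le_mul hfac (add_le_add ?_ ?_) ?_ (by positivity)
  · refine le_trans (Finset.sum_le_sum (g := fun n => z n ^ 2) fun n _ => ?_)
      (Finset.sum_le_sum_of_subset_of_nonneg (Finset.range_mono (Nat.sub_le N r))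
        fun _ _ _ => by positivity)
    have e : v n * v n = ((z n * z (n + r)) ^ 2) • (shift (y n • v₁ - n • v₂)
        (F (y (n + r) - y n)) * shift (y n • v₁ - n • v₂) (F (y (n + r) - y n))) := by
      simp only [hv, smul_mul_smul_comm, pow_two]
    rw [e, map_smul, smul_eq_mul]
    have h1 : m (shift (y n • v₁ - n • v₂) (F (y (n + r) - y n)) *
        shift (y n • v₁ - n • v₂) (F (y (n + r) - y n))) ≤ 1 :=
      m.le_of_le fun x => (le_abs_self _).trans (abs_mul_le_one (hFb _ _) (hFb _ _))
    refine (mul_le_of_le_one_right (by positivity) h1).trans ?_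
    rw [mul_pow]
    refine mul_le_of_le_one_right (by positivity) ?_
    exact (sq_le_one_iff_abs_le_one _).2 (hz _)
  · refine mul_le_mul_of_nonneg_left (Finset.sum_le_sum fun s hs => ?_) zero_le_two
    have hs2 : s < S := (Finset.mem_Ico.1 hs).2
    refine le_trans (le_of_eq ?_) (abs_sum_quadruple_le (z := z) hy
      (fun i => m (F i.1 * shift (i.2.1 • v₁ - s • v₂) (F i.2.2)))
      (fun i => m.abs_le_of_abs_le fun x => abs_mul_le_one (hFb _ _) (hFb _ _)) hr2 hs2)
    congr 1
    refine Finset.sum_congr rfl fun n _ => ?_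
    have hinc := increment_le hy n s
    -- The product is a scalar times a translate of a function determined by the three increments,
    -- and invariance of `m` removes the translation.
    have e : v n * v (n + s) = (z n * z (n + r) * z (n + s) * z (n + s + r)) •
        shift (y n • v₁ - n • v₂) (F (y (n + r) - y n) *
          shift ((y (n + s) - y n) • v₁ - s • v₂) (F (y (n + s + r) - y (n + s)))) := by
      rw [shift_mul, shift_shift]
      have e1 : y n • v₁ - n • v₂ + ((y (n + s) - y n) • v₁ - s • v₂) =
          y (n + s) • v₁ - (n + s) • v₂ := by
        have : y (n + s) • v₁ = y n • v₁ + (y (n + s) - y n) • v₁ := by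
          rw [← add_smul, Nat.add_sub_cancel' hinc.1]
        rw [this, add_smul]; abel
      rw [e1]
      simp only [hv, smul_mul_smul_comm, mul_assoc]
    rw [e, map_smul, smul_eq_mul, m.invariant]
  · exact add_nonneg (Finset.sum_nonneg fun n _ => m.sq_nonneg _)
      (mul_nonneg zero_le_two (Finset.sum_nonneg fun n _ => abs_nonneg _))

end Means

/-! ### The mean ergodic theorem and the cubic lower bound -/

section Means

variable {G : Type*} [AddCommGroup G] [TopologicalSpace G] [DiscreteTopology G]

/-- The average of the translates of `f` by `0, v, …, (L - 1) • v`. -/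
noncomputable def shiftAvg (L : ℕ) (v : G) (f : G →ᵇ ℝ) : G →ᵇ ℝ :=
  (L : ℝ)⁻¹ • ∑ i ∈ Finset.range L, shift (i • v) f

lemma shiftAvg_apply (L : ℕ) (v : G) (f : G →ᵇ ℝ) (x : G) :
    shiftAvg L v f x = (L : ℝ)⁻¹ * ∑ i ∈ Finset.range L, f (x + i • v) := by
  simp [shiftAvg]

lemma abs_shiftAvg_le {L : ℕ} {v : G} {f : G →ᵇ ℝ} {c : ℝ} (hc : 0 ≤ c) (hf : ∀ x, |f x| ≤ c)
    (x : G) : |shiftAvg L v f x| ≤ c := by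
  rw [shiftAvg_apply, abs_mul, abs_of_nonneg (by positivity : (0 : ℝ) ≤ (L : ℝ)⁻¹)]
  rcases Nat.eq_zero_or_pos L with rfl | hL
  · simpa using hc
  have hL' : (0 : ℝ) < L := by exact_mod_cast hL
  rw [inv_mul_le_iff₀ hL']
  refine (Finset.abs_sum_le_sum_abs _ _).trans ((Finset.sum_le_sum fun i _ => hf _).trans ?_)
  simp

lemma shiftAvg_nonneg {L : ℕ} {v : G} {f : G →ᵇ ℝ} (hf : ∀ x, 0 ≤ f x) (x : G) :
    0 ≤ shiftAvg L v f x := by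
  rw [shiftAvg_apply]
  exact mul_nonneg (by positivity) (Finset.sum_nonneg fun i _ => hf _)

/-- The convex hull of the forward orbit of `f` under translation by `v`. -/
def orbitHull (v : G) (f : G →ᵇ ℝ) : Set (G →ᵇ ℝ) :=
  convexHull ℝ (Set.range fun i : ℕ => shift (i • v) f)

/-- Shifting a window by one step changes only its two end terms. -/
lemma abs_sum_shift_sub_le {G : Type*} [AddCommGroup G] [TopologicalSpace G] (v : G) (f : G →ᵇ ℝ) (i H : ℕ) (x : G) :
    |∑ j ∈ Finset.range H, f (x + j • v + i • v) - ∑ j ∈ Finset.range H, f (x + j • v)| ≤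
      2 * i * ‖f‖ := by
  induction i with
  | zero => simp
  | succ i ih =>
    have h1 : ∑ j ∈ Finset.range H, f (x + j • v + (i + 1) • v) -
        ∑ j ∈ Finset.range H, f (x + j • v + i • v) = f (x + H • v + i • v) - f (x + i • v) := by
      rw [← Finset.sum_sub_distrib]
      have := Finset.sum_range_sub (fun j => f (x + j • v + i • v)) H
      rw [zero_smul, add_zero] at this
      rw [← this]
      refine Finset.sum_congr rfl fun j _ => ?_
      congr 2
      rw [add_smul, add_smul]; abel
    have h2 : |f (x + H • v + i • v) - f (x + i • v)| ≤ 2 * ‖f‖ := by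
      refine (abs_sub _ _).trans ?_
      have a1 := f.norm_coe_le_norm (x + H • v + i • v)
      have a2 := f.norm_coe_le_norm (x + i • v)
      rw [Real.norm_eq_abs] at a1 a2
      linarith
    have h3 := abs_add_le (∑ j ∈ Finset.range H, f (x + j • v + (i + 1) • v) -
        ∑ j ∈ Finset.range H, f (x + j • v + i • v))
      (∑ j ∈ Finset.range H, f (x + j • v + i • v) - ∑ j ∈ Finset.range H, f (x + j • v))
    rw [sub_add_sub_cancel, h1] at h3
    push_cast
    linarith

/-- The set of `p` with this property is convex and contains every translate of `f`. So all elements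
of the hull have asymptotically the same averages, uniformly in `x`. -/
lemma exists_abs_sum_sub_le_of_mem_orbitHull {v : G} {f p : G →ᵇ ℝ} (hp : p ∈ orbitHull v f) :
    ∃ B : ℝ, ∀ (H : ℕ) (x : G), |∑ j ∈ Finset.range H, p (x + j • v) -
      ∑ j ∈ Finset.range H, f (x + j • v)| ≤ B := by
  have hsub : orbitHull v f ⊆ {p : G →ᵇ ℝ | ∃ B : ℝ, ∀ (H : ℕ) (x : G),
      |∑ j ∈ Finset.range H, p (x + j • v) - ∑ j ∈ Finset.range H, f (x + j • v)| ≤ B} := by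
    refine convexHull_min ?_ ?_
    · rintro _ ⟨i, rfl⟩
      exact ⟨2 * i * ‖f‖, fun H x => abs_sum_shift_sub_le v f i H x⟩
    · rintro p ⟨B, hB⟩ q ⟨B', hB'⟩ s t hs ht hst
      refine ⟨s * B + t * B', fun H x => ?_⟩
      have e : ∑ j ∈ Finset.range H, (s • p + t • q) (x + j • v) -
          ∑ j ∈ Finset.range H, f (x + j • v) =
          s * (∑ j ∈ Finset.range H, p (x + j • v) - ∑ j ∈ Finset.range H, f (x + j • v)) +
          t * (∑ j ∈ Finset.range H, q (x + j • v) - ∑ j ∈ Finset.range H, f (x + j • v)) := by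
        simp only [BoundedContinuousFunction.coe_add, BoundedContinuousFunction.coe_smul,
          Pi.add_apply, smul_eq_mul, Finset.sum_add_distrib, ← Finset.mul_sum]
        linear_combination (∑ j ∈ Finset.range H, f (x + j • v)) * hst
      rw [e]
      refine (abs_add_le _ _).trans ?_
      rw [abs_mul, abs_mul, abs_of_nonneg hs, abs_of_nonneg ht]
      exact add_le_add (mul_le_mul_of_nonneg_left (hB H x) hs)
        (mul_le_mul_of_nonneg_left (hB' H x) ht)
  exact hsub hp

lemma shift_shiftAvg_mem_orbitHull (v : G) (f : G →ᵇ ℝ) {L : ℕ} (hL : 0 < L) (n : ℕ) :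
    shift (n • v) (shiftAvg L v f) ∈ orbitHull v f := by
  have e : shift (n • v) (shiftAvg L v f) =
      ∑ i ∈ Finset.range L, (L : ℝ)⁻¹ • shift ((n + i) • v) f := by
    rw [shiftAvg, shift_smul, shift_sum, Finset.smul_sum]
    simp only [shift_shift, add_smul]
  rw [e]
  refine (convex_convexHull ℝ _).sum_mem (fun i _ => by positivity) ?_ fun i _ =>
    subset_convexHull ℝ _ ⟨n + i, rfl⟩
  have : (L : ℝ) ≠ 0 := by positivity
  simp [this]

namespace InvariantMean

variable (m : InvariantMean G)

lemma sq_shiftAvg_le (v : G) (p : G →ᵇ ℝ) (H : ℕ) :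
    m (shiftAvg H v p * shiftAvg H v p) ≤ m (p * p) := by
  rcases Nat.eq_zero_or_pos H with rfl | hH
  · simpa [shiftAvg] using m.sq_nonneg p
  have h := m.sq_sum_le (Finset.range H) (fun i => shift (i • v) p)
  simp only [← shift_mul, m.invariant, Finset.sum_const, Finset.card_range, nsmul_eq_mul] at h
  have hH' : (0 : ℝ) < H := by exact_mod_cast hH
  rw [shiftAvg, smul_mul_smul_comm, map_smul, smul_eq_mul, ← mul_inv, inv_mul_le_iff₀ (by positivity)]
  linarith

/-- Long averages of `f` are uniformly close to those of `p`, and averaging does not increase the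
seminorm. Hence long averages nearly minimize the seminorm over the hull. -/
lemma eventually_sq_shiftAvg_le (v : G) (f : G →ᵇ ℝ) {p : G →ᵇ ℝ} (hp : p ∈ orbitHull v f)
    {ε : ℝ} (hε : 0 < ε) :
    ∃ H₀ : ℕ, ∀ H ≥ H₀, m (shiftAvg H v f * shiftAvg H v f) ≤ m (p * p) + ε := by
  obtain ⟨B, hB⟩ := exists_abs_sum_sub_le_of_mem_orbitHull hp
  have hB0 : 0 ≤ B := (abs_nonneg _).trans (hB 0 0)
  obtain ⟨H₀, hH₀⟩ := exists_nat_gt (B * (‖f‖ + ‖p‖) / ε)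
  refine ⟨H₀ + 1, fun H hH => ?_⟩
  have hH' : (0 : ℝ) < H := by
    have : 0 < H := by omega
    exact_mod_cast this
  have hHε : B * (‖f‖ + ‖p‖) ≤ H * ε := by
    have : (H₀ : ℝ) ≤ H := by exact_mod_cast (by omega : H₀ ≤ H)
    rw [div_lt_iff₀ hε] at hH₀
    nlinarith
  have hpt : ∀ x, (shiftAvg H v f * shiftAvg H v f - shiftAvg H v p * shiftAvg H v p) x ≤ ε := by
    intro x
    have h1 : |shiftAvg H v f x - shiftAvg H v p x| ≤ (H : ℝ)⁻¹ * B := by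
      rw [shiftAvg_apply, shiftAvg_apply, ← mul_sub, abs_mul, abs_of_pos (by positivity), abs_sub_comm]
      exact mul_le_mul_of_nonneg_left (hB H x) (by positivity)
    have h2 : |shiftAvg H v f x + shiftAvg H v p x| ≤ ‖f‖ + ‖p‖ :=
      (abs_add_le _ _).trans (add_le_add
        (abs_shiftAvg_le (norm_nonneg _) (fun x => f.norm_coe_le_norm x) x)
        (abs_shiftAvg_le (norm_nonneg _) (fun x => p.norm_coe_le_norm x) x))
    have h3 : (shiftAvg H v f * shiftAvg H v f - shiftAvg H v p * shiftAvg H v p) x =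
        (shiftAvg H v f x - shiftAvg H v p x) * (shiftAvg H v f x + shiftAvg H v p x) := by
      simp only [BoundedContinuousFunction.coe_mul, BoundedContinuousFunction.coe_sub,
        Pi.mul_apply, Pi.sub_apply]
      ring
    rw [h3]
    refine (le_abs_self _).trans ?_
    rw [abs_mul]
    refine (mul_le_mul h1 h2 (abs_nonneg _) (by positivity)).trans ?_
    rw [mul_assoc, inv_mul_le_iff₀ hH']
    exact hHε
  have h4 := m.le_of_le hpt
  rw [map_sub] at h4
  have := m.sq_shiftAvg_le v p H
  linarith

/-- The mean ergodic theorem for an invariant mean, in Cauchy form. -/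
lemma shiftAvg_cauchy (v : G) (f : G →ᵇ ℝ) {ε : ℝ} (hε : 0 < ε) :
    ∃ H₀ : ℕ, 0 < H₀ ∧ ∀ H ≥ H₀, ∀ K ≥ H₀, ∀ n : ℕ,
      m ((shift (n • v) (shiftAvg H v f) - shiftAvg K v f) *
        (shift (n • v) (shiftAvg H v f) - shiftAvg K v f)) ≤ ε := by
  set Q : Set ℝ := (fun p => m (p * p)) '' orbitHull v f with hQ
  have hne : Q.Nonempty := ⟨_, _, subset_convexHull ℝ _ ⟨0, rfl⟩, rfl⟩
  have hbdd : BddBelow Q := ⟨0, by rintro _ ⟨p, _, rfl⟩; exact m.sq_nonneg p⟩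
  -- Near-minimizers of a convex set are close by the parallelogram law. Both averages exceed the
  -- infimum by at most `ε / 4`, and their midpoint is in the hull, which gives `2 * ε / 4 + 2 * ε /
  -- 4`. Uniformity in `n` comes from invariance of `m`.
  obtain ⟨_, ⟨p, hp, rfl⟩, hlt⟩ := Real.lt_sInf_add_pos hne (by positivity : 0 < ε / 8)
  obtain ⟨H₀, hH₀⟩ := m.eventually_sq_shiftAvg_le v f hp (by positivity : 0 < ε / 8)
  refine ⟨H₀ + 1, by omega, fun H hH K hK n => ?_⟩
  have hx := hH₀ H (by omega)
  have hy := hH₀ K (by omega)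
  set X := shift (n • v) (shiftAvg H v f) with hX
  set Y := shiftAvg K v f with hY
  have hX2 : m (X * X) = m (shiftAvg H v f * shiftAvg H v f) := by
    rw [hX, ← shift_mul, m.invariant]
  have hXm : X ∈ orbitHull v f := shift_shiftAvg_mem_orbitHull v f (by omega) n
  have hYm : Y ∈ orbitHull v f := by
    have := shift_shiftAvg_mem_orbitHull v f (L := K) (by omega) 0
    rwa [zero_smul, shift_zero] at this
  have hmid : (2⁻¹ : ℝ) • X + (2⁻¹ : ℝ) • Y ∈ orbitHull v f :=
    convex_convexHull ℝ _ hXm hYm (by norm_num) (by norm_num) (by norm_num)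
  have hinf := csInf_le hbdd ⟨_, hmid, rfl⟩
  have hpar : (X - Y) * (X - Y) = (2 : ℝ) • (X * X) + (2 : ℝ) • (Y * Y) -
      (4 : ℝ) • (((2⁻¹ : ℝ) • X + (2⁻¹ : ℝ) • Y) * ((2⁻¹ : ℝ) • X + (2⁻¹ : ℝ) • Y)) := by
    ext x
    simp only [BoundedContinuousFunction.coe_mul, BoundedContinuousFunction.coe_sub,
      BoundedContinuousFunction.coe_add, BoundedContinuousFunction.coe_smul,
      Pi.mul_apply, Pi.sub_apply, Pi.add_apply, smul_eq_mul]
    ring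
  rw [hpar, map_sub, map_add, map_smul, map_smul, map_smul, smul_eq_mul, smul_eq_mul, smul_eq_mul]
  simp only at hlt hinf
  linarith

lemma abs_mul_shiftAvg_sub_le (v : G) (f : G →ᵇ ℝ) {ε : ℝ} (hε : 0 < ε) :
    ∃ H₀ : ℕ, 0 < H₀ ∧ ∀ H ≥ H₀, ∀ K ≥ H₀, ∀ (n : ℕ) (h : G →ᵇ ℝ), (∀ x, |h x| ≤ 1) →
      |m (h * shift (n • v) (shiftAvg H v f)) - m (h * shiftAvg K v f)| ≤ ε := by
  obtain ⟨H₀, h0, hH₀⟩ := m.shiftAvg_cauchy v f (by positivity : 0 < ε ^ 2)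
  refine ⟨H₀, h0, fun H hH K hK n h hh => ?_⟩
  rw [← map_sub, ← mul_sub]
  refine (m.abs_mul_le_sqrt hh).trans ?_
  rw [← Real.sqrt_sq hε.le]
  exact Real.sqrt_le_sqrt (hH₀ H hH K hK n)

/-- The function `1 / (F + η)`, for `F` nonnegative and `η > 0`. -/
noncomputable def _root_.invAdd (F : G →ᵇ ℝ) (hF : ∀ x, 0 ≤ F x) (η : ℝ) (hη : 0 < η) : G →ᵇ ℝ :=
  BoundedContinuousFunction.ofNormedAddCommGroupDiscrete (fun x => (F x + η)⁻¹) η⁻¹ fun x => by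
    have := hF x
    rw [Real.norm_eq_abs, abs_of_nonneg (by positivity)]
    exact inv_anti₀ hη (by linarith)

/-- The weight `1 / (A + η)` inherits the near-invariance of `A`, so `f` may be replaced by its
average `A`, and `A / (A + η) ≤ 1`. The number `η` avoids division by zero. -/
lemma mul_invAdd_shiftAvg_le (v : G) {f : G →ᵇ ℝ} (hf : ∀ x, 0 ≤ f x) (hf1 : ∀ x, f x ≤ 1)
    {η : ℝ} (hη : 0 < η) {ε : ℝ} (hε : 0 < ε) :
    ∃ H₀ : ℕ, ∀ L ≥ H₀,
      m (f * invAdd (shiftAvg L v f) (shiftAvg_nonneg hf) η hη) ≤ 1 + ε := by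
  obtain ⟨H₀, hpos, hH₀⟩ := m.abs_mul_shiftAvg_sub_le v f (by positivity : 0 < ε * η ^ 2)
  refine ⟨H₀, fun L hL => ?_⟩
  set A := shiftAvg L v f with hA
  have hA0 : ∀ x, 0 ≤ A x := shiftAvg_nonneg hf
  set φ := invAdd A hA0 η hη with hφ
  have hφx : ∀ x, φ x = (A x + η)⁻¹ := fun x => rfl
  have hφ0 : ∀ x, 0 ≤ φ x := fun x => by rw [hφx]; have := hA0 x; positivity
  have hφ1 : ∀ x, η * φ x ≤ 1 := fun x => by
    rw [hφx, ← div_eq_mul_inv, div_le_one (by have := hA0 x; positivity)]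
    have := hA0 x; linarith
  have hL0 : (0 : ℝ) < L := by exact_mod_cast (by omega : 0 < L)
  have step : ∀ i : ℕ, m (f * φ) ≤ m (shift (i • v) f * φ) + ε := by
    intro i
    set h : G →ᵇ ℝ := (η ^ 2) • (shift (i • v) f * (φ * shift (i • v) φ)) with hh
    have hb : ∀ x, |h x| ≤ 1 := by
      intro x
      have e : h x = f (x + i • v) * ((η * φ x) * (η * φ (x + i • v))) := by
        simp only [hh, BoundedContinuousFunction.coe_mul, BoundedContinuousFunction.coe_smul,
          Pi.mul_apply, smul_eq_mul, shift_apply]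
        ring
      have a1 : |f (x + i • v)| ≤ 1 := abs_le.2 ⟨by linarith [hf (x + i • v)], hf1 _⟩
      have a2 : ∀ x, |η * φ x| ≤ 1 := fun x =>
        abs_le.2 ⟨by have := mul_nonneg hη.le (hφ0 x); linarith, hφ1 x⟩
      rw [e]
      exact abs_mul_le_one a1 (abs_mul_le_one (a2 _) (a2 _))
    have hd := hH₀ L hL L hL i h hb
    -- This is `1/b - 1/a = (a - b) / (a b)` for `a = A + η` and its translate `b`.
    have e : h * A - h * shift (i • v) A =
        (η ^ 2) • (shift (i • v) f * shift (i • v) φ - shift (i • v) f * φ) := by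
      ext x
      have p1 : A x + η ≠ 0 := by have := hA0 x; positivity
      have p2 : A (x + i • v) + η ≠ 0 := by have := hA0 (x + i • v); positivity
      simp only [hh, BoundedContinuousFunction.coe_mul, BoundedContinuousFunction.coe_smul,
        BoundedContinuousFunction.coe_sub, Pi.sub_apply,
        Pi.mul_apply, smul_eq_mul, shift_apply, hφx]
      field_simp
      ring
    have e2 : m (h * A) - m (h * shift (i • v) A) =
        η ^ 2 * (m (f * φ) - m (shift (i • v) f * φ)) := by
      rw [← map_sub, e, map_smul, map_sub, ← shift_mul, m.invariant, smul_eq_mul]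
    have hd' := (abs_le.1 hd).1
    have : η ^ 2 * (m (f * φ) - m (shift (i • v) f * φ)) ≤ η ^ 2 * ε := by linarith
    have := le_of_mul_le_mul_left this (by positivity)
    linarith
  have hsum : ∑ i ∈ Finset.range L, m (f * φ) ≤
      ∑ i ∈ Finset.range L, (m (shift (i • v) f * φ) + ε) := Finset.sum_le_sum fun i _ => step i
  have hAφ : m (A * φ) = (L : ℝ)⁻¹ * ∑ i ∈ Finset.range L, m (shift (i • v) f * φ) := by
    rw [hA, shiftAvg, smul_mul_assoc, map_smul, Finset.sum_mul, map_sum, smul_eq_mul]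
  have hAφ1 : m (A * φ) ≤ 1 := m.le_of_le fun x => by
    rw [BoundedContinuousFunction.coe_mul, Pi.mul_apply, hφx, ← div_eq_mul_inv,
      div_le_one (by have := hA0 x; positivity)]
    linarith
  rw [Finset.sum_add_distrib, Finset.sum_const, Finset.sum_const, Finset.card_range, nsmul_eq_mul,
    nsmul_eq_mul] at hsum
  rw [hAφ, inv_mul_le_iff₀ hL0] at hAφ1
  have : (L : ℝ) * m (f * φ) ≤ L * (1 + ε) := by linarith
  exact le_of_mul_le_mul_left this hL0

lemma _root_.three_le_mul_add_inv {x y : ℝ} (hx : 0 < x) (hy : 0 < y) :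
    3 ≤ x * y + x⁻¹ + y⁻¹ := by
  set s := √(x * y) with hs
  have hs2 : s ^ 2 = x * y := Real.sq_sqrt (by positivity)
  have hspos : 0 < s := Real.sqrt_pos.2 (by positivity)
  have h2 : 2 * s ≤ x + y := by nlinarith [_root_.sq_nonneg (x - y)]
  -- The product expands to `s⁴ - 3 s² + 2 s`, which is AM-GM for three numbers after `x + y ≥ 2 s`.
  have h3 : 0 ≤ s * ((s - 1) ^ 2 * (s + 2)) := by positivity
  have h4 : 3 * (x * y) ≤ (x * y) * (x * y) + x + y := by rw [← hs2]; nlinarith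
  have h5 : x * y + x⁻¹ + y⁻¹ = ((x * y) * (x * y) + x + y) / (x * y) := by field_simp; ring
  rw [h5, le_div_iff₀ (by positivity)]
  exact h4

/-- A function with values in `[0, 1]` correlates with the product of its averages along two
directions at least as much as if they were independent. -/
lemma cube_sub_le (v₁ v₂ : G) {f : G →ᵇ ℝ} (hf : ∀ x, 0 ≤ f x) (hf1 : ∀ x, f x ≤ 1)
    {ε : ℝ} (hε : 0 < ε) :
    ∃ H₀ : ℕ, ∀ L ≥ H₀, ∀ K ≥ H₀,
      m f ^ 3 - ε ≤ m (f * (shiftAvg L v₁ f * shiftAvg K v₂ f)) := by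
  set η := min 1 (ε / 6) with hη'
  have hη : 0 < η := by positivity
  have hη1 : η ≤ 1 := min_le_left _ _
  have hη2 : η ≤ ε / 6 := min_le_right _ _
  obtain ⟨H₁, h₁⟩ := m.mul_invAdd_shiftAvg_le v₁ hf hf1 hη (by positivity : 0 < ε / 4)
  obtain ⟨H₂, h₂⟩ := m.mul_invAdd_shiftAvg_le v₂ hf hf1 hη (by positivity : 0 < ε / 4)
  refine ⟨max H₁ H₂, fun L hL K hK => ?_⟩
  have k1 := h₁ L (le_trans (le_max_left _ _) hL)
  have k2 := h₂ K (le_trans (le_max_right _ _) hK)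
  set A := shiftAvg L v₁ f
  set B := shiftAvg K v₂ f
  have hA : ∀ x, 0 ≤ A x := shiftAvg_nonneg hf
  have hB : ∀ x, 0 ≤ B x := shiftAvg_nonneg hf
  have habs : ∀ x, |f x| ≤ 1 := fun x => abs_le.2 ⟨by linarith [hf x], hf1 x⟩
  have hA1 : ∀ x, A x ≤ 1 := fun x => (abs_le.1 (abs_shiftAvg_le zero_le_one habs x)).2
  have hB1 : ∀ x, B x ≤ 1 := fun x => (abs_le.1 (abs_shiftAvg_le zero_le_one habs x)).2
  set φ := invAdd A (shiftAvg_nonneg hf) η hη with hφ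
  set ψ := invAdd B (shiftAvg_nonneg hf) η hη with hψ
  have hφx : ∀ x, φ x = (A x + η)⁻¹ := fun x => rfl
  have hψx : ∀ x, ψ x = (B x + η)⁻¹ := fun x => rfl
  set α := m f with hα
  have hα0 : 0 ≤ α := m.nonneg f hf
  have hα1 : α ≤ 1 := m.le_of_le hf1
  have hP : 0 ≤ m (f * (A * B)) :=
    m.nonneg _ fun x => mul_nonneg (hf x) (mul_nonneg (hA x) (hB x))
  rcases hα0.eq_or_lt with h0 | hpos
  · rw [← h0]; norm_num; linarith
  -- AM-GM is applied at `(A + η) / α` and `(B + η) / α`, multiplied by `f` and integrated. The last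
  -- two terms contribute at most `α * (1 + ε / 4)` each, leaving `α * (1 - ε / 2)` for the first.
  have key := m.mono (f := (3 : ℝ) • f)
    (g := (α⁻¹ ^ 2) • (f * (A * B) + (3 * η) • (1 : G →ᵇ ℝ)) + α • (f * φ) + α • (f * ψ))
    (fun x => by
      have p1 : 0 < A x + η := by have := hA x; positivity
      have p2 : 0 < B x + η := by have := hB x; positivity
      have h3 := three_le_mul_add_inv (x := (A x + η) / α) (y := (B x + η) / α)
        (by positivity) (by positivity)
      have h4 := mul_le_mul_of_nonneg_right h3 (hf x)
      have h5 : f x * ((A x + η) * (B x + η)) ≤ f x * (A x * B x) + 3 * η := by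
        have : (A x + η) * (B x + η) ≤ A x * B x + 3 * η := by
          nlinarith [hA1 x, hB1 x, hA x, hB x]
        nlinarith [hf x, hf1 x]
      have h6 := mul_le_mul_of_nonneg_left h5 (by positivity : 0 ≤ α⁻¹ ^ 2)
      simp only [BoundedContinuousFunction.coe_mul, BoundedContinuousFunction.coe_smul,
        BoundedContinuousFunction.coe_add, Pi.add_apply, BoundedContinuousFunction.coe_one,
        Pi.one_apply, Pi.mul_apply, smul_eq_mul, hφx, hψx]
      rw [inv_div, inv_div] at h4
      have e : ((A x + η) / α * ((B x + η) / α) + α / (A x + η) + α / (B x + η)) * f x =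
          α⁻¹ ^ 2 * (f x * ((A x + η) * (B x + η))) + α * (f x * (A x + η)⁻¹) +
            α * (f x * (B x + η)⁻¹) := by
        simp only [div_eq_mul_inv]; ring
      rw [e] at h4
      rw [mul_one]
      linarith)
  rw [map_add, map_add, map_smul, map_smul, map_smul, map_smul, map_add, m.apply_smul_one,
    smul_eq_mul, smul_eq_mul, smul_eq_mul, smul_eq_mul] at key
  have q1 := mul_le_mul_of_nonneg_left k1 hα0
  have q2 := mul_le_mul_of_nonneg_left k2 hα0
  have q3 : α * (1 - ε / 2) ≤ α⁻¹ ^ 2 * (m (f * (A * B)) + 3 * η) := by linarith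
  have q4 := mul_le_mul_of_nonneg_left q3 (by positivity : 0 ≤ α ^ 2)
  have e : α ^ 2 * (α⁻¹ ^ 2 * (m (f * (A * B)) + 3 * η)) = m (f * (A * B)) + 3 * η := by
    field_simp
  rw [e] at q4
  have q5 : α ^ 3 * (ε / 2) ≤ ε / 2 :=
    mul_le_of_le_one_left (by positivity) (pow_le_one₀ hα0 hα1)
  nlinarith

end InvariantMean

end Means

/-! ### Independence and second moments -/

/-- The number of selections strictly before index `n`. -/
def selectionCount (x : ℕ → ℕ) (n : ℕ) : ℕ := ∑ j ∈ Finset.range n, x j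

/-- The selection sequence `x` centered by its means `p`. -/
def centered (p : ℕ → ℝ) (x : ℕ → ℕ) (n : ℕ) : ℝ := (x n : ℝ) - p n

lemma dependsOn_centered (p : ℕ → ℝ) {n M : ℕ} (h : n < M) :
    DependsOn (fun x : ℕ → ℕ => centered p x n) (Set.Iio M) := by
  intro x y hxy
  simp only [centered, hxy n h]

lemma dependsOn_selectionCount {n M : ℕ} (h : n ≤ M) :
    DependsOn (fun x : ℕ → ℕ => selectionCount x n) (Set.Iio M) := by
  intro x y hxy
  exact Finset.sum_congr rfl fun j hj => hxy j (lt_of_lt_of_le (Finset.mem_range.1 hj) h)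

section Probability

variable {Ω : Type*} [MeasurableSpace Ω] {P : Measure Ω} [IsProbabilityMeasure P]
  {ξ : ℕ → Ω → ℕ}

/-- The factor lives on a countable space, which makes measurability and transfer of independence
automatic. -/
lemma exists_factor {β : Type*} {M : ℕ} {Φ : (ℕ → ℕ) → β} (hΦ : DependsOn Φ (Set.Iio M)) :
    ∃ Φ' : ((Finset.range M) → ℕ) → β, ∀ x : ℕ → ℕ, Φ x = Φ' fun i => x i := by
  refine ⟨fun t => Φ fun i => if h : i ∈ Finset.range M then t ⟨i, h⟩ else 0, fun x => ?_⟩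
  refine hΦ fun i hi => ?_
  rw [dif_pos (Finset.mem_range.2 hi)]

lemma measurable_of_dependsOn (hm : ∀ n, Measurable (ξ n)) {M : ℕ} {Φ : (ℕ → ℕ) → ℝ}
    (hΦ : DependsOn Φ (Set.Iio M)) : Measurable fun ω => Φ fun n => ξ n ω := by
  obtain ⟨Φ', h⟩ := exists_factor hΦ
  simp only [h]
  exact (measurable_of_countable Φ').comp (measurable_pi_lambda _ fun i => hm i)

lemma integrable_of_dependsOn (hm : ∀ n, Measurable (ξ n)) (h1 : ∀ n ω, ξ n ω ≤ 1) {M : ℕ}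
    {Φ : (ℕ → ℕ) → ℝ} (hΦ : DependsOn Φ (Set.Iio M)) :
    Integrable (fun ω => Φ fun n => ξ n ω) P := by
  have hmeas := measurable_of_dependsOn hm hΦ
  obtain ⟨Φ', h⟩ := exists_factor hΦ
  refine Integrable.of_bound hmeas.aestronglyMeasurable
    (∑ t ∈ Fintype.piFinset fun _ : Finset.range M => Finset.range 2, ‖Φ' t‖) ?_
  filter_upwards with ω
  rw [h]
  refine Finset.single_le_sum (f := fun t => ‖Φ' t‖) (fun _ _ => norm_nonneg _) ?_
  rw [Fintype.mem_piFinset]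
  intro i
  have := h1 i ω
  exact Finset.mem_range.2 (by omega)

/-- Coordinate `M` is independent of the earlier ones and centered: this is the martingale
difference property. -/
lemma integral_mul_centered_eq_zero (hm : ∀ n, Measurable (ξ n)) (h1 : ∀ n ω, ξ n ω ≤ 1)
    (hind : iIndepFun ξ P) {p : ℕ → ℝ} (hp : ∀ n, ∫ ω, (ξ n ω : ℝ) ∂P = p n) {M : ℕ}
    {Φ : (ℕ → ℕ) → ℝ} (hΦ : DependsOn Φ (Set.Iio M)) :
    ∫ ω, Φ (fun n => ξ n ω) * centered p (fun n => ξ n ω) M ∂P = 0 := by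
  have hmeas := measurable_of_dependsOn hm hΦ
  have hcen := measurable_of_dependsOn hm (dependsOn_centered p M.lt_succ_self)
  obtain ⟨Φ', h⟩ := exists_factor hΦ
  have hi := hind.indepFun_finset (Finset.range M) {M} (by simp) hm
  have hi2 : IndepFun (fun ω => Φ fun n => ξ n ω)
      (fun ω => centered p (fun n => ξ n ω) M) P := by
    have := hi.comp (φ := Φ')
      (ψ := fun t => (t ⟨M, Finset.mem_singleton_self M⟩ : ℝ) - p M)
      (measurable_of_countable _) (measurable_of_countable _)
    simp only [h]
    exact this
  rw [hi2.integral_fun_mul_eq_mul_integral hmeas.aestronglyMeasurable hcen.aestronglyMeasurable]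
  have hx : Integrable (fun ω => (ξ M ω : ℝ)) P :=
    integrable_of_dependsOn hm h1 (Φ := fun x => (x M : ℝ)) (M := M + 1)
      (fun x y hxy => congrArg Nat.cast (hxy M M.lt_succ_self))
  have : ∫ ω, centered p (fun n => ξ n ω) M ∂P = 0 := by
    simp only [centered]
    rw [integral_sub hx (integrable_const _), hp]
    simp
  rw [this, mul_zero]

lemma dependsOn_mono {β : Type*} {M M' : ℕ} (h : M ≤ M') {Φ : (ℕ → ℕ) → β}
    (hΦ : DependsOn Φ (Set.Iio M)) : DependsOn Φ (Set.Iio M') := fun _ _ hxy =>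
  hΦ fun i hi => hxy i (lt_of_lt_of_le hi h)

lemma dependsOn_sum_mul_centered {p : ℕ → ℝ} {c : ℕ} {Ψ : ℕ → (ℕ → ℕ) → ℝ}
    (hΨ : ∀ n, DependsOn (Ψ n) (Set.Iio (n + c))) (N : ℕ) :
    DependsOn (fun x => ∑ n ∈ Finset.range N, Ψ n x * centered p x (n + c)) (Set.Iio (N + c)) := by
  intro x y hxy
  refine Finset.sum_congr rfl fun n hn => ?_
  have hn' := Finset.mem_range.1 hn
  rw [dependsOn_mono (by omega) (hΨ n) hxy]
  congr 1
  exact dependsOn_centered p (by omega) hxy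

/-- Orthogonality of martingale differences. -/
lemma integral_sq_sum_mul_centered (hm : ∀ n, Measurable (ξ n)) (h1 : ∀ n ω, ξ n ω ≤ 1)
    (hind : iIndepFun ξ P) {p : ℕ → ℝ} (hp : ∀ n, ∫ ω, (ξ n ω : ℝ) ∂P = p n) {c : ℕ}
    {Ψ : ℕ → (ℕ → ℕ) → ℝ} (hΨ : ∀ n, DependsOn (Ψ n) (Set.Iio (n + c))) (N : ℕ) :
    ∫ ω, (∑ n ∈ Finset.range N, Ψ n (fun i => ξ i ω) * centered p (fun i => ξ i ω) (n + c)) ^ 2 ∂P =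
      ∑ n ∈ Finset.range N,
        ∫ ω, (Ψ n (fun i => ξ i ω) * centered p (fun i => ξ i ω) (n + c)) ^ 2 ∂P := by
  induction N with
  | zero => simp
  | succ N ih =>
    have hS := dependsOn_sum_mul_centered (p := p) hΨ N
    set S : (ℕ → ℕ) → ℝ := fun x => ∑ n ∈ Finset.range N, Ψ n x * centered p x (n + c) with hSdef
    have hcen := dependsOn_centered p (N + c).lt_succ_self
    have hΨN := hΨ N
    have e : ∀ ω, (∑ n ∈ Finset.range (N + 1),
        Ψ n (fun i => ξ i ω) * centered p (fun i => ξ i ω) (n + c)) ^ 2 =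
        S (fun i => ξ i ω) ^ 2 + 2 * (S (fun i => ξ i ω) * Ψ N (fun i => ξ i ω) *
          centered p (fun i => ξ i ω) (N + c)) +
          (Ψ N (fun i => ξ i ω) * centered p (fun i => ξ i ω) (N + c)) ^ 2 := by
      intro ω
      rw [Finset.sum_range_succ]
      simp only [hSdef]
      ring
    have i1 : Integrable (fun ω => S (fun i => ξ i ω) ^ 2) P :=
      integrable_of_dependsOn hm h1 (Φ := fun x => S x ^ 2) (M := N + c)
        fun x y hxy => by simp only [hS hxy]
    have i2 : Integrable (fun ω => 2 * (S (fun i => ξ i ω) * Ψ N (fun i => ξ i ω) *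
          centered p (fun i => ξ i ω) (N + c))) P :=
      integrable_of_dependsOn hm h1 (Φ := fun x => 2 * (S x * Ψ N x * centered p x (N + c)))
        (M := N + c + 1) fun x y hxy => by
          simp only [dependsOn_mono (Nat.le_succ _) hS hxy, hcen hxy,
            dependsOn_mono (Nat.le_succ _) hΨN hxy]
    have i3 : Integrable (fun ω => (Ψ N (fun i => ξ i ω) *
        centered p (fun i => ξ i ω) (N + c)) ^ 2) P :=
      integrable_of_dependsOn hm h1 (Φ := fun x => (Ψ N x * centered p x (N + c)) ^ 2)
        (M := N + c + 1) fun x y hxy => by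
          simp only [hcen hxy, dependsOn_mono (Nat.le_succ _) hΨN hxy]
    have hzero := integral_mul_centered_eq_zero hm h1 hind hp (M := N + c)
      (Φ := fun x => S x * Ψ N x) fun x y hxy => by simp only [hS hxy, hΨN hxy]
    have i12 := i1.add i2
    rw [Pi.add_def] at i12
    rw [integral_congr_ae (Eventually.of_forall e), integral_add i12 i3,
      integral_add i1 i2, integral_const_mul, hzero, Finset.sum_range_succ, ← ih]
    ring

lemma abs_centered_le {p : ℕ → ℝ} (hp0 : ∀ n, 0 ≤ p n) (hp1 : ∀ n, p n ≤ 1) {x : ℕ → ℕ}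
    (hx : ∀ n, x n ≤ 1) (n : ℕ) : |centered p x n| ≤ 1 := by
  have h1 : (x n : ℝ) ≤ 1 := by exact_mod_cast hx n
  have h2 : (0 : ℝ) ≤ x n := Nat.cast_nonneg _
  exact abs_le.2 ⟨by unfold centered; linarith [hp1 n], by unfold centered; linarith [hp0 n]⟩

lemma integral_centered_sq_le (hm : ∀ n, Measurable (ξ n)) (h1 : ∀ n ω, ξ n ω ≤ 1)
    {p : ℕ → ℝ} (hp : ∀ n, ∫ ω, (ξ n ω : ℝ) ∂P = p n) (n : ℕ) :
    ∫ ω, centered p (fun i => ξ i ω) n ^ 2 ∂P ≤ p n := by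
  have e : ∀ ω, centered p (fun i => ξ i ω) n ^ 2 = (1 - 2 * p n) * (ξ n ω : ℝ) + p n ^ 2 := by
    intro ω
    have : (ξ n ω : ℝ) ^ 2 = ξ n ω := by
      have := h1 n ω
      interval_cases ξ n ω <;> norm_num
    unfold centered
    linear_combination this
  have hx : Integrable (fun ω => (ξ n ω : ℝ)) P :=
    integrable_of_dependsOn hm h1 (Φ := fun x => (x n : ℝ)) (M := n + 1)
      (fun x y hxy => congrArg Nat.cast (hxy n n.lt_succ_self))
  rw [integral_congr_ae (Eventually.of_forall e), integral_add (hx.const_mul _) (integrable_const _),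
    integral_const_mul, hp]
  simp only [integral_const, probReal_univ, smul_eq_mul, one_mul]
  nlinarith [sq_nonneg (p n)]

/-- The variance of the number of selections is at most its mean. -/
lemma integral_selectionCount_sub_sq_le (hm : ∀ n, Measurable (ξ n)) (h1 : ∀ n ω, ξ n ω ≤ 1)
    (hind : iIndepFun ξ P) {p : ℕ → ℝ} (hp : ∀ n, ∫ ω, (ξ n ω : ℝ) ∂P = p n) (N : ℕ) :
    ∫ ω, ((selectionCount (fun i => ξ i ω) N : ℝ) - ∑ n ∈ Finset.range N, p n) ^ 2 ∂P ≤
      ∑ n ∈ Finset.range N, p n := by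
  have h := integral_sq_sum_mul_centered hm h1 hind hp (c := 0) (Ψ := fun _ _ => 1)
    (fun n x y _ => rfl) N
  simp only [one_mul, add_zero] at h
  have e : ∀ ω, ((selectionCount (fun i => ξ i ω) N : ℝ) - ∑ n ∈ Finset.range N, p n) =
      ∑ n ∈ Finset.range N, centered p (fun i => ξ i ω) n := by
    intro ω
    simp only [selectionCount, centered, Finset.sum_sub_distrib]
    push_cast; rfl
  simp only [e]
  rw [h]
  exact Finset.sum_le_sum fun n _ => integral_centered_sq_le hm h1 hp n

/-- The count at `n + s + r` involves only selections strictly before that index, so the condition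
is independent of the last factor of the correlation. -/
lemma dependsOn_increment (n r s : ℕ) (i : ℕ × ℕ × ℕ) :
    DependsOn (fun x : ℕ → ℕ => if selectionCount x (n + r) = selectionCount x n + i.1 ∧
      selectionCount x (n + s) = selectionCount x n + i.2.1 ∧
      selectionCount x (n + s + r) = selectionCount x (n + s) + i.2.2 then (1 : ℝ) else 0)
      (Set.Iio (n + s + r)) := by
  intro x y hxy
  have a := fun (k : ℕ) (hk : k ≤ n + s + r) => dependsOn_selectionCount hk hxy
  simp only at a
  simp only [a (n + r) (by omega), a n (by omega), a (n + s) (by omega), a (n + s + r) le_rfl]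

lemma dependsOn_incrementCorrelation (p : ℕ → ℝ) (N r s : ℕ) (i : ℕ × ℕ × ℕ) :
    DependsOn (fun x => incrementCorrelation (centered p x) (selectionCount x) N r s i)
      (Set.Iio (N + s + r + 1)) := by
  intro x y hxy
  refine Finset.sum_congr rfl fun n hn => ?_
  have hn' := Finset.mem_range.1 hn
  have a := fun (k : ℕ) (hk : k < N + s + r + 1) => dependsOn_centered p hk hxy
  have b := dependsOn_mono (by omega) (dependsOn_increment n r s i) hxy
  simp only at a b
  rw [a n (by omega), a (n + r) (by omega), a (n + s) (by omega), a (n + s + r) (by omega), b]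

/-- Since `r, s > 0`, the index `n + s + r` is strictly the largest, so the summands are orthogonal
martingale differences and only diagonal terms remain. The bound is uniform in the set `T` of
increments. -/
lemma integral_sum_incrementCorrelation_sq_le (hm : ∀ n, Measurable (ξ n))
    (h1 : ∀ n ω, ξ n ω ≤ 1) (hind : iIndepFun ξ P) {p : ℕ → ℝ}
    (hp : ∀ n, ∫ ω, (ξ n ω : ℝ) ∂P = p n) (hp0 : ∀ n, 0 ≤ p n) (hp1 : ∀ n, p n ≤ 1)
    {N r s : ℕ} (hr : 0 < r) (hs : 0 < s) (T : Finset (ℕ × ℕ × ℕ)) :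
    ∑ i ∈ T, ∫ ω, incrementCorrelation (centered p fun n => ξ n ω)
      (selectionCount fun n => ξ n ω) N r s i ^ 2 ∂P ≤ N := by
  set ind : ℕ × ℕ × ℕ → ℕ → (ℕ → ℕ) → ℝ := fun i n x =>
    if selectionCount x (n + r) = selectionCount x n + i.1 ∧
      selectionCount x (n + s) = selectionCount x n + i.2.1 ∧
      selectionCount x (n + s + r) = selectionCount x (n + s) + i.2.2 then (1 : ℝ) else 0 with hind'
  have hindint : ∀ i n, Integrable (fun ω => ind i n fun n => ξ n ω) P := fun i n =>
    integrable_of_dependsOn hm h1 (dependsOn_increment n r s i)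
  have step : ∀ i, ∫ ω, incrementCorrelation (centered p fun n => ξ n ω)
      (selectionCount fun n => ξ n ω) N r s i ^ 2 ∂P ≤
      ∑ n ∈ Finset.range (N - r - s), ∫ ω, ind i n (fun n => ξ n ω) ∂P := by
    intro i
    set Ψ : ℕ → (ℕ → ℕ) → ℝ := fun n x =>
      centered p x n * centered p x (n + r) * centered p x (n + s) * ind i n x with hΨ
    have hdep : ∀ n, DependsOn (Ψ n) (Set.Iio (n + (s + r))) := by
      intro n x y hxy
      have a := fun (k : ℕ) (hk : k < n + (s + r)) => dependsOn_centered p hk hxy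
      rw [← add_assoc] at hxy
      have b := dependsOn_increment n r s i hxy
      simp only at a b
      simp only [hΨ, hind']
      rw [a n (by omega), a (n + r) (by omega), a (n + s) (by omega), b]
    have e : ∀ ω, incrementCorrelation (centered p fun n => ξ n ω)
        (selectionCount fun n => ξ n ω) N r s i = ∑ n ∈ Finset.range (N - r - s),
          Ψ n (fun n => ξ n ω) * centered p (fun n => ξ n ω) (n + (s + r)) := by
      intro ω
      refine Finset.sum_congr rfl fun n _ => ?_
      simp only [hΨ, hind', ← add_assoc]
      ring
    simp only [e]
    rw [integral_sq_sum_mul_centered hm h1 hind hp hdep]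
    refine Finset.sum_le_sum fun n _ => integral_mono ?_ (hindint i n) fun ω => ?_
    · exact integrable_of_dependsOn hm h1 (M := n + (s + r) + 1)
        (Φ := fun x => (Ψ n x * centered p x (n + (s + r))) ^ 2) fun x y hxy => by
          simp only [dependsOn_mono (Nat.le_succ _) (hdep n) hxy,
            dependsOn_centered p (n + (s + r)).lt_succ_self hxy]
    · have a := abs_centered_le hp0 hp1 (fun n => h1 n ω)
      have h4 : |centered p (fun n => ξ n ω) n * centered p (fun n => ξ n ω) (n + r) *
          centered p (fun n => ξ n ω) (n + s) * centered p (fun n => ξ n ω) (n + (s + r))| ≤ 1 :=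
        abs_mul_le_one (abs_mul_le_one (abs_mul_le_one (a _) (a _)) (a _)) (a _)
      have h5 := (sq_le_one_iff_abs_le_one _).2 h4
      simp only [hΨ, hind']
      split_ifs
      · rw [mul_one]; exact h5
      · simp
  refine (Finset.sum_le_sum fun i _ => step i).trans ?_
  rw [Finset.sum_comm]
  -- For fixed `n` the events for distinct increment triples are disjoint, so their probabilities
  -- sum to at most `1`.
  have hle : ∀ n ∈ Finset.range (N - r - s), ∑ i ∈ T, ∫ ω, ind i n (fun n => ξ n ω) ∂P ≤ 1 := by
    intro n _
    rw [← integral_finsetSum _ fun i _ => hindint i n]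
    have : ∀ ω, ∑ i ∈ T, ind i n (fun n => ξ n ω) ≤ 1 := by
      intro ω
      set y := selectionCount fun n => ξ n ω
      have hsub : ∀ i ∈ T, ind i n (fun n => ξ n ω) ≤
          if i = (y (n + r) - y n, y (n + s) - y n, y (n + s + r) - y (n + s)) then 1 else 0 := by
        rintro ⟨i, j, k⟩ _
        simp only [hind', Prod.mk.injEq]
        split_ifs with g1 g2
        · exact le_rfl
        · exfalso; apply g2; change y _ = y _ + _ ∧ y _ = y _ + _ ∧ y _ = y _ + _ at g1; omega
        · exact zero_le_one
        · exact le_rfl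
      refine (Finset.sum_le_sum hsub).trans ?_
      rw [Finset.sum_ite_eq']
      split_ifs <;> norm_num
    calc _ ≤ ∫ ω, (1 : ℝ) ∂P :=
          integral_mono (integrable_finsetSum _ fun i _ => hindint i n) (integrable_const _) this
      _ = 1 := by simp
  refine (Finset.sum_le_sum hle).trans ?_
  simp only [Finset.sum_const, Finset.card_range, nsmul_eq_mul, mul_one, Nat.cast_le]
  omega

end Probability

/-! ### The expectation of the double van der Corput bound -/

lemma doubleCorputBound_nonneg (z : ℕ → ℝ) (y : ℕ → ℕ) (N R S : ℕ) {l : ℝ} (hl : 0 < l) :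
    0 ≤ doubleCorputBound z y N R S l := by
  unfold doubleCorputBound
  positivity

/-- AM-GM with parameter `κ` turns absolute values into squares, whose expectations are controlled;
its cost is `κ` times the size `R² S` of the increment box. -/
lemma doubleCorputBound_le (z : ℕ → ℝ) (y : ℕ → ℕ) {N R S : ℕ} (hR : 0 < R) (hS : 0 < S)
    (hRN : R ≤ N) (hSN : S ≤ N) {l κ : ℝ} (hl : 0 < l) (hκ : 0 < κ) :
    doubleCorputBound z y N R S l ≤
      (2 * N * l + 4 * N ^ 2 * l⁻¹ * (κ * (R ^ 2 * S))) +
      (2 * N / R + 4 * N ^ 2 * l⁻¹ / S) * ∑ n ∈ Finset.range N, z n ^ 2 +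
      (4 * N ^ 2 * l⁻¹ * κ⁻¹ / (R * S)) * ∑ r ∈ Finset.Ico 1 R, ∑ s ∈ Finset.Ico 1 S,
        ∑ i ∈ incrementBox R S, incrementCorrelation z y N r s i ^ 2 := by
  have hR' : (0 : ℝ) < R := by exact_mod_cast hR
  have hS' : (0 : ℝ) < S := by exact_mod_cast hS
  have hRN' : (R : ℝ) ≤ N := by exact_mod_cast hRN
  have hSN' : (S : ℝ) ≤ N := by exact_mod_cast hSN
  set A := ∑ n ∈ Finset.range N, z n ^ 2 with hA
  have hA0 : 0 ≤ A := Finset.sum_nonneg fun _ _ => sq_nonneg _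
  set Q : ℕ → ℕ → ℝ := fun r s => ∑ i ∈ incrementBox R S, incrementCorrelation z y N r s i ^ 2
  have hq : ∀ r s, 2 * ∑ i ∈ incrementBox R S, |incrementCorrelation z y N r s i| ≤
      κ * (R ^ 2 * S) + κ⁻¹ * Q r s := by
    intro r s
    have h : ∑ i ∈ incrementBox R S, 2 * |incrementCorrelation z y N r s i| ≤
        ∑ i ∈ incrementBox R S, (κ + κ⁻¹ * incrementCorrelation z y N r s i ^ 2) := by
      refine Finset.sum_le_sum fun i _ => ?_
      have := two_mul_le_add_inv_mul_sq (x := |incrementCorrelation z y N r s i|) hκ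
      rwa [sq_abs] at this
    rw [← Finset.mul_sum, Finset.sum_add_distrib, Finset.sum_const, ← Finset.mul_sum] at h
    refine h.trans_eq ?_
    simp only [incrementBox, Finset.card_product, Finset.card_range, nsmul_eq_mul, Q]
    push_cast
    ring
  have hcard : ∀ (M : ℕ) (c : ℝ), 0 ≤ c → ∑ _s ∈ Finset.Ico 1 M, c ≤ M * c := by
    intro M c hc
    rw [Finset.sum_const, Nat.card_Ico, nsmul_eq_mul]
    exact mul_le_mul_of_nonneg_right (by exact_mod_cast Nat.sub_le M 1) hc
  have hs : ∀ r, 2 * ∑ s ∈ Finset.Ico 1 S, ∑ i ∈ incrementBox R S,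
      |incrementCorrelation z y N r s i| ≤
      S * (κ * (R ^ 2 * S)) + κ⁻¹ * ∑ s ∈ Finset.Ico 1 S, Q r s := by
    intro r
    rw [Finset.mul_sum]
    refine (Finset.sum_le_sum fun s _ => hq r s).trans ?_
    rw [Finset.sum_add_distrib]
    exact add_le_add (hcard _ _ (by positivity)) (Finset.mul_sum _ _ _).ge
  have hfS : ((N : ℝ) + S) / S ≤ 2 * N / S := by gcongr; linarith
  have hfR : ((N : ℝ) + R) / R ≤ 2 * N / R := by gcongr; linarith
  have hr : ∑ r ∈ Finset.Ico 1 R, (l + l⁻¹ * (((N : ℝ) + S) / S * (A +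
      2 * ∑ s ∈ Finset.Ico 1 S, ∑ i ∈ incrementBox R S, |incrementCorrelation z y N r s i|))) ≤
      R * (l + l⁻¹ * (2 * N / S * (A + S * (κ * (R ^ 2 * S))))) +
        l⁻¹ * (2 * N / S * κ⁻¹) * ∑ r ∈ Finset.Ico 1 R, ∑ s ∈ Finset.Ico 1 S, Q r s := by
    calc _ ≤ ∑ r ∈ Finset.Ico 1 R, ((l + l⁻¹ * (2 * N / S * (A + S * (κ * (R ^ 2 * S))))) +
          l⁻¹ * (2 * N / S * κ⁻¹) * ∑ s ∈ Finset.Ico 1 S, Q r s) := by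
            refine Finset.sum_le_sum fun r _ => ?_
            have h1 : l⁻¹ * (((N : ℝ) + S) / S * (A + 2 * ∑ s ∈ Finset.Ico 1 S,
                ∑ i ∈ incrementBox R S, |incrementCorrelation z y N r s i|)) ≤
                l⁻¹ * (2 * N / S * (A + (S * (κ * (R ^ 2 * S)) +
                  κ⁻¹ * ∑ s ∈ Finset.Ico 1 S, Q r s))) := by
              have := hs r
              gcongr
            refine (add_le_add_right h1 l).trans_eq ?_
            ring
      _ ≤ _ := by
            rw [Finset.sum_add_distrib, ← Finset.mul_sum]
            exact add_le_add (hcard _ _ (by positivity)) le_rfl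
  unfold doubleCorputBound
  have hB : 0 ≤ A + ∑ r ∈ Finset.Ico 1 R, (l + l⁻¹ * (((N : ℝ) + S) / S * (A +
      2 * ∑ s ∈ Finset.Ico 1 S, ∑ i ∈ incrementBox R S,
        |incrementCorrelation z y N r s i|))) := by positivity
  refine (mul_le_mul hfR (add_le_add_right hr A) hB (by positivity)).trans_eq ?_
  field_simp
  ring

section Probability

variable {Ω : Type*} [MeasurableSpace Ω] {P : Measure Ω} [IsProbabilityMeasure P]
  {ξ : ℕ → Ω → ℕ}

lemma dependsOn_doubleCorputBound (p : ℕ → ℝ) (N R S : ℕ) (l : ℝ) :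
    DependsOn (fun x => doubleCorputBound (centered p x) (selectionCount x) N R S l)
      (Set.Iio (N + S + R + 1)) := by
  intro x y hxy
  have a : ∀ n ∈ Finset.range N, centered p x n ^ 2 = centered p y n ^ 2 := fun n hn => by
    have hn' := Finset.mem_range.1 hn
    have := dependsOn_centered p (show n < N + S + R + 1 by omega) hxy
    simp only at this
    rw [this]
  have b : ∀ r ∈ Finset.Ico 1 R, ∀ s ∈ Finset.Ico 1 S, ∀ i,
      incrementCorrelation (centered p x) (selectionCount x) N r s i =
      incrementCorrelation (centered p y) (selectionCount y) N r s i := fun r hr s hs i => by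
    have hr' := (Finset.mem_Ico.1 hr).2
    have hs' := (Finset.mem_Ico.1 hs).2
    exact dependsOn_mono (by omega) (dependsOn_incrementCorrelation p N r s i) hxy
  simp only [doubleCorputBound, Finset.sum_congr rfl a]
  congr 2
  refine Finset.sum_congr rfl fun r hr => ?_
  congr 5
  refine Finset.sum_congr rfl fun s hs => Finset.sum_congr rfl fun i _ => ?_
  rw [b r hr s hs i]

lemma integral_doubleCorputBound_le (hm : ∀ n, Measurable (ξ n))
    (h1 : ∀ n ω, ξ n ω ≤ 1) (hind : iIndepFun ξ P) {p : ℕ → ℝ}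
    (hp : ∀ n, ∫ ω, (ξ n ω : ℝ) ∂P = p n) (hp0 : ∀ n, 0 ≤ p n) (hp1 : ∀ n, p n ≤ 1)
    {N R S : ℕ} (hR : 0 < R) (hS : 0 < S) (hRN : R ≤ N) (hSN : S ≤ N) {l κ : ℝ}
    (hl : 0 < l) (hκ : 0 < κ) :
    ∫ ω, doubleCorputBound (centered p fun n => ξ n ω) (selectionCount fun n => ξ n ω)
      N R S l ∂P ≤
      2 * (N * l) + 2 * (N / R * ∑ n ∈ Finset.range N, p n) +
        4 * (N ^ 2 * l⁻¹ / S * ∑ n ∈ Finset.range N, p n) +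
        4 * (N ^ 2 * l⁻¹ * (κ * (R ^ 2 * S) + κ⁻¹ * N)) := by
  have hR' : (0 : ℝ) < R := by exact_mod_cast hR
  have hS' : (0 : ℝ) < S := by exact_mod_cast hS
  have hAint : ∀ n, Integrable (fun ω => centered p (fun i => ξ i ω) n ^ 2) P := fun n =>
    integrable_of_dependsOn hm h1 (M := n + 1) (Φ := fun x => centered p x n ^ 2)
      fun x y hxy => by
        have := dependsOn_centered p n.lt_succ_self hxy
        simp only at this
        simp only [this]
  have hQint : ∀ r s i, Integrable (fun ω => incrementCorrelation (centered p fun n => ξ n ω)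
      (selectionCount fun n => ξ n ω) N r s i ^ 2) P := fun r s i =>
    integrable_of_dependsOn hm h1 (M := N + s + r + 1)
      (Φ := fun x => incrementCorrelation (centered p x) (selectionCount x) N r s i ^ 2)
      fun x y hxy => by
        have := dependsOn_incrementCorrelation p N r s i hxy
        simp only at this
        simp only [this]
  have hA : ∫ ω, ∑ n ∈ Finset.range N, centered p (fun i => ξ i ω) n ^ 2 ∂P ≤
      ∑ n ∈ Finset.range N, p n := by
    rw [integral_finsetSum _ fun n _ => hAint n]
    exact Finset.sum_le_sum fun n _ => integral_centered_sq_le hm h1 hp n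
  have hAi : Integrable (fun ω => ∑ n ∈ Finset.range N, centered p (fun i => ξ i ω) n ^ 2) P :=
    integrable_finsetSum _ fun n _ => hAint n
  have hQi1 : ∀ r s, Integrable (fun ω => ∑ i ∈ incrementBox R S, incrementCorrelation
      (centered p fun n => ξ n ω) (selectionCount fun n => ξ n ω) N r s i ^ 2) P :=
    fun r s => integrable_finsetSum _ fun i _ => hQint r s i
  have hQi2 : ∀ r, Integrable (fun ω => ∑ s ∈ Finset.Ico 1 S, ∑ i ∈ incrementBox R S,
      incrementCorrelation (centered p fun n => ξ n ω) (selectionCount fun n => ξ n ω)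
        N r s i ^ 2) P :=
    fun r => integrable_finsetSum _ fun s _ => hQi1 r s
  have hQi : Integrable (fun ω => ∑ r ∈ Finset.Ico 1 R, ∑ s ∈ Finset.Ico 1 S,
      ∑ i ∈ incrementBox R S, incrementCorrelation (centered p fun n => ξ n ω)
        (selectionCount fun n => ξ n ω) N r s i ^ 2) P :=
    integrable_finsetSum _ fun r _ => hQi2 r
  have hQ : ∫ ω, ∑ r ∈ Finset.Ico 1 R, ∑ s ∈ Finset.Ico 1 S,
      ∑ i ∈ incrementBox R S, incrementCorrelation (centered p fun n => ξ n ω)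
        (selectionCount fun n => ξ n ω) N r s i ^ 2 ∂P ≤ R * (S * N) := by
    rw [integral_finsetSum _ fun r _ => hQi2 r]
    calc _ ≤ ∑ _r ∈ Finset.Ico 1 R, ∑ _s ∈ Finset.Ico 1 S, (N : ℝ) := by
          refine Finset.sum_le_sum fun r hr => ?_
          rw [integral_finsetSum _ fun s _ => hQi1 r s]
          refine Finset.sum_le_sum fun s hs => ?_
          rw [integral_finsetSum _ fun i _ => hQint r s i]
          exact integral_sum_incrementCorrelation_sq_le hm h1 hind hp hp0 hp1
            (Finset.mem_Ico.1 hr).1 (Finset.mem_Ico.1 hs).1 _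
      _ ≤ _ := by
          simp only [Finset.sum_const, Nat.card_Ico, nsmul_eq_mul]
          gcongr <;> omega
  have hBi := integrable_of_dependsOn (P := P) hm h1 (dependsOn_doubleCorputBound p N R S l)
  set c0 : ℝ := 2 * N * l + 4 * N ^ 2 * l⁻¹ * (κ * (R ^ 2 * S)) with hc0
  set c1 : ℝ := 2 * N / R + 4 * N ^ 2 * l⁻¹ / S with hc1
  set c2 : ℝ := 4 * N ^ 2 * l⁻¹ * κ⁻¹ / (R * S) with hc2
  have i1 := (integrable_const c0 (μ := P)).add (hAi.const_mul c1)
  rw [Pi.add_def] at i1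
  have hle := integral_mono hBi (i1.add (hQi.const_mul c2)) fun ω =>
    doubleCorputBound_le (centered p fun n => ξ n ω) (selectionCount fun n => ξ n ω)
      hR hS hRN hSN hl hκ
  rw [Pi.add_def] at hle
  rw [integral_add i1 (hQi.const_mul c2), integral_add (integrable_const _) (hAi.const_mul c1),
    integral_const_mul, integral_const_mul] at hle
  simp only [integral_const, probReal_univ, smul_eq_mul, one_mul] at hle
  refine hle.trans ?_
  have t1 := mul_le_mul_of_nonneg_left hA (by positivity : 0 ≤ c1)
  have t2 := mul_le_mul_of_nonneg_left hQ (by positivity : 0 ≤ c2)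
  refine (add_le_add (add_le_add_right t1 c0) t2).trans_eq ?_
  rw [hc0, hc1, hc2]
  field_simp
  ring

/-- Nonnegative random variables with summable expectations tend to zero almost surely. -/
lemma ae_tendsto_zero_of_integral_le {Ω : Type*} [MeasurableSpace Ω] {P : Measure Ω}
    {f : ℕ → Ω → ℝ} (hf : ∀ k, Integrable (f k) P)
    (h0 : ∀ k ω, 0 ≤ f k ω) {b : ℕ → ℝ} (hb : Summable b) (hfb : ∀ k, ∫ ω, f k ω ∂P ≤ b k) :
    ∀ᵐ ω ∂P, Tendsto (fun k => f k ω) atTop (nhds 0) := by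
  have hb0 : ∀ k, 0 ≤ b k := fun k => (integral_nonneg (h0 k)).trans (hfb k)
  have hmeas : ∀ k, AEMeasurable (fun ω => ENNReal.ofReal (f k ω)) P := fun k =>
    (hf k).aestronglyMeasurable.aemeasurable.ennreal_ofReal
  have hfin : ∫⁻ ω, ∑' k, ENNReal.ofReal (f k ω) ∂P ≠ ⊤ := by
    rw [lintegral_tsum hmeas]
    have : ∀ k, ∫⁻ ω, ENNReal.ofReal (f k ω) ∂P ≤ ENNReal.ofReal (b k) := fun k => by
      rw [← ofReal_integral_eq_lintegral_ofReal (hf k) (Eventually.of_forall (h0 k))]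
      exact ENNReal.ofReal_le_ofReal (hfb k)
    refine ne_top_of_le_ne_top ?_ (ENNReal.tsum_le_tsum this)
    exact hb.tsum_ofReal_ne_top
  filter_upwards [ae_lt_top' (AEMeasurable.tsum hmeas) hfin] with ω hω
  have := ENNReal.tendsto_atTop_zero_of_tsum_ne_top hω.ne
  have h2 := (ENNReal.tendsto_toReal ENNReal.zero_ne_top).comp this
  simpa [Function.comp_def, ENNReal.toReal_ofReal (h0 _ _)] using h2

end Probability

/-! ### Choice of parameters and sampling scale -/

/-- The length of the short shifts in the first application of van der Corput's inequality. -/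
noncomputable def firstShift (a : ℝ) (N : ℕ) : ℕ := ⌈(N : ℝ) ^ (a + 1 / 112)⌉₊

/-- The length of the short shifts in the second application of van der Corput's inequality. -/
noncomputable def secondShift (a : ℝ) (N : ℕ) : ℕ := ⌈(N : ℝ) ^ (3 * a + 1 / 56)⌉₊

lemma ceil_rpow_bounds {N : ℕ} (hN : 1 ≤ N) {e : ℝ} (h0 : 0 ≤ e) (h1 : e ≤ 1) :
    0 < ⌈(N : ℝ) ^ e⌉₊ ∧ ⌈(N : ℝ) ^ e⌉₊ ≤ N ∧ (N : ℝ) ^ e ≤ ⌈(N : ℝ) ^ e⌉₊ ∧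
      (⌈(N : ℝ) ^ e⌉₊ : ℝ) ≤ 2 * (N : ℝ) ^ e := by
  have hN' : (1 : ℝ) ≤ N := by exact_mod_cast hN
  have hp : 1 ≤ (N : ℝ) ^ e := Real.one_le_rpow hN' h0
  refine ⟨Nat.ceil_pos.2 (by linarith), ?_, Nat.le_ceil _, ?_⟩
  · rw [Nat.ceil_le]
    calc (N : ℝ) ^ e ≤ (N : ℝ) ^ (1 : ℝ) := Real.rpow_le_rpow_of_exponent_le hN' h1
      _ = N := Real.rpow_one _
  · have := Nat.ceil_lt_add_one (by linarith : 0 ≤ (N : ℝ) ^ e)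
    linarith

/-- The target is `W²` with a saving of `N ^ (-1/112)`, given `W ≥ N ^ (1 - a)`. The first three
terms dictate `l`, the first shift length and the second, in turn with `l`; `κ` balances `κ R² S`
against `κ⁻¹ N`. The constant is `2 + 2 + 4 + 4 * 9`. -/
lemma corput_parameters_bound {a : ℝ} (ha0 : 0 < a) (ha : a < 1 / 14) {N : ℕ} (hN : 1 ≤ N) {W : ℝ}
    (hW : (N : ℝ) ^ (1 - a) ≤ W) {l κ : ℝ} (hl : l = (N : ℝ) ^ (1 - 2 * a - 1 / 112))
    (hκ : κ = (N : ℝ) ^ (1 / 2 - 5 / 2 * a - 1 / 56)) :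
    2 * (N * l) + 2 * (N / firstShift a N * W) + 4 * (N ^ 2 * l⁻¹ / secondShift a N * W) +
        4 * (N ^ 2 * l⁻¹ * (κ * (firstShift a N ^ 2 * secondShift a N) + κ⁻¹ * N)) ≤
      44 * (N : ℝ) ^ (-(1 / 112) : ℝ) * W ^ 2 := by
  obtain ⟨R0, -, R1, R2⟩ := ceil_rpow_bounds hN (e := a + 1 / 112) (by linarith) (by linarith)
  obtain ⟨S0, -, S1, S2⟩ := ceil_rpow_bounds hN (e := 3 * a + 1 / 56) (by linarith) (by linarith)
  change 0 < firstShift a N at R0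
  change _ ≤ (firstShift a N : ℝ) at R1
  change (firstShift a N : ℝ) ≤ _ at R2
  change 0 < secondShift a N at S0
  change _ ≤ (secondShift a N : ℝ) at S1
  change (secondShift a N : ℝ) ≤ _ at S2
  have hN' : (1 : ℝ) ≤ N := by exact_mod_cast hN
  have hn : (0 : ℝ) < N := by linarith
  set R : ℝ := ((firstShift a N : ℕ) : ℝ)
  set S : ℝ := ((secondShift a N : ℕ) : ℝ)
  set n : ℝ := (N : ℝ)
  have hRpos : 0 < R := lt_of_lt_of_le (by positivity) R1
  have hSpos : 0 < S := lt_of_lt_of_le (by positivity) S1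
  have hWpos : 0 < W := lt_of_lt_of_le (by positivity) hW
  have n1 : n = n ^ (1 : ℝ) := (Real.rpow_one n).symm
  have n2 : n ^ 2 = n ^ (2 : ℝ) := by norm_cast
  have hli : l⁻¹ = n ^ (-(1 - 2 * a - 1 / 112)) := by rw [hl, Real.rpow_neg hn.le]
  have hκi : κ⁻¹ = n ^ (-(1 / 2 - 5 / 2 * a - 1 / 56)) := by rw [hκ, Real.rpow_neg hn.le]
  have hW2 : n ^ (2 - 2 * a) ≤ W ^ 2 := by
    have : n ^ (2 - 2 * a) = (n ^ (1 - a)) ^ 2 := by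
      rw [pow_two, ← Real.rpow_add hn]; congr 1; ring
    rw [this]
    exact pow_le_pow_left₀ (by positivity) hW 2
  have T1 : n * l ≤ n ^ (-(1 / 112) : ℝ) * W ^ 2 := by
    calc n * l = n ^ (-(1 / 112) : ℝ) * n ^ (2 - 2 * a) := by
          rw [hl, ← Real.rpow_add hn]
          nth_rewrite 1 [n1]
          rw [← Real.rpow_add hn]; congr 1; ring
      _ ≤ _ := by gcongr
  have T2 : n / R * W ≤ n ^ (-(1 / 112) : ℝ) * W ^ 2 := by
    have : n / R ≤ n ^ (-(1 / 112) : ℝ) * W := by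
      calc n / R ≤ n / n ^ (a + 1 / 112) := by gcongr
        _ = n ^ (-(1 / 112) : ℝ) * n ^ (1 - a) := by
          rw [← Real.rpow_add hn]
          nth_rewrite 1 [n1]
          rw [← Real.rpow_sub hn]; congr 1; ring
        _ ≤ _ := by gcongr
    calc _ ≤ (n ^ (-(1 / 112) : ℝ) * W) * W := by gcongr
      _ = _ := by ring
  have T3 : n ^ 2 * l⁻¹ / S * W ≤ n ^ (-(1 / 112) : ℝ) * W ^ 2 := by
    have : n ^ 2 * l⁻¹ / S ≤ n ^ (-(1 / 112) : ℝ) * W := by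
      calc n ^ 2 * l⁻¹ / S ≤ n ^ 2 * l⁻¹ / n ^ (3 * a + 1 / 56) := by
            have : 0 ≤ n ^ 2 * l⁻¹ := by rw [hli]; positivity
            gcongr
        _ = n ^ (-(1 / 112) : ℝ) * n ^ (1 - a) := by
          rw [hli, n2, ← Real.rpow_add hn, ← Real.rpow_sub hn, ← Real.rpow_add hn]; congr 1; ring
        _ ≤ _ := by gcongr
    calc _ ≤ (n ^ (-(1 / 112) : ℝ) * W) * W := by gcongr
      _ = _ := by ring
  have T4 : n ^ 2 * l⁻¹ * (κ * (R ^ 2 * S) + κ⁻¹ * n) ≤ 9 * (n ^ (-(1 / 112) : ℝ) * W ^ 2) := by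
    have hκ0 : 0 ≤ κ := by rw [hκ]; positivity
    have hRS : R ^ 2 * S ≤ 8 * n ^ (5 * a + 1 / 28) := by
      calc R ^ 2 * S ≤ (2 * n ^ (a + 1 / 112)) ^ 2 * (2 * n ^ (3 * a + 1 / 56)) := by gcongr
        _ = 8 * (n ^ (a + 1 / 112) * n ^ (a + 1 / 112) * n ^ (3 * a + 1 / 56)) := by ring
        _ = _ := by rw [← Real.rpow_add hn, ← Real.rpow_add hn]; congr 2; ring
    have h1 : κ * (R ^ 2 * S) + κ⁻¹ * n ≤ 9 * n ^ (1 / 2 + 5 / 2 * a + 1 / 56) := by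
      have e1 : κ * (8 * n ^ (5 * a + 1 / 28)) = 8 * n ^ (1 / 2 + 5 / 2 * a + 1 / 56) := by
        rw [hκ, mul_left_comm, ← Real.rpow_add hn]; congr 2; ring
      have e2 : κ⁻¹ * n = n ^ (1 / 2 + 5 / 2 * a + 1 / 56) := by
        rw [hκi]
        nth_rewrite 2 [n1]
        rw [← Real.rpow_add hn]; congr 1; ring
      have := mul_le_mul_of_nonneg_left hRS hκ0
      linarith
    calc n ^ 2 * l⁻¹ * (κ * (R ^ 2 * S) + κ⁻¹ * n)
        ≤ n ^ 2 * l⁻¹ * (9 * n ^ (1 / 2 + 5 / 2 * a + 1 / 56)) := by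
          refine mul_le_mul_of_nonneg_left h1 ?_
          rw [hli]; positivity
      _ = 9 * n ^ (3 / 2 + 9 / 2 * a + 3 / 112) := by
          rw [hli, n2, ← Real.rpow_add hn, mul_left_comm, ← Real.rpow_add hn]; congr 2; ring
      -- The comparison `3/2 + 9a/2 + 3/112 ≤ 2 - 2a - 1/112` is exactly `a ≤ 1/14`.
      _ ≤ 9 * n ^ (-(1 / 112) + (2 - 2 * a) : ℝ) := by
          refine mul_le_mul_of_nonneg_left ?_ (by norm_num)
          exact Real.rpow_le_rpow_of_exponent_le hN' (by linarith)
      _ = 9 * (n ^ (-(1 / 112) : ℝ) * n ^ (2 - 2 * a)) := by rw [Real.rpow_add hn]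
      _ ≤ _ := by gcongr
  linarith

/-- The exponent of `sampleScale`. -/
@[irreducible] def sampleExponent : ℕ := 224

lemma sampleExponent_eq : sampleExponent = 224 := by rw [sampleExponent]

/-- A sequence of polynomial growth, fast enough for the Borel-Cantelli lemma. -/
@[irreducible] def sampleScale (k : ℕ) : ℕ := (k + 1) ^ sampleExponent

lemma one_le_sampleScale (k : ℕ) : 1 ≤ sampleScale k := by
  rw [sampleScale]; exact Nat.one_le_pow _ _ k.succ_pos

lemma sampleScale_lt_succ (k : ℕ) : sampleScale k < sampleScale (k + 1) := by
  rw [sampleScale, sampleScale]; exact Nat.pow_lt_pow_left (by omega) (by rw [sampleExponent_eq]; norm_num)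

lemma strictMono_sampleScale : StrictMono sampleScale := strictMono_nat_of_lt_succ sampleScale_lt_succ

/-- The exponent `224 = 2 * 112` converts the power saving into the summable sequence `(k + 1)⁻²`.
-/
lemma sampleScale_rpow_neg_le (k : ℕ) {e : ℝ} (he : 1 / 112 ≤ e) :
    (sampleScale k : ℝ) ^ (-e) ≤ (((k + 1 : ℕ) : ℝ) ^ 2)⁻¹ := by
  have h1 : (1 : ℝ) ≤ sampleScale k := by exact_mod_cast one_le_sampleScale k
  calc (sampleScale k : ℝ) ^ (-e) ≤ (sampleScale k : ℝ) ^ (-(1 / 112) : ℝ) :=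
        Real.rpow_le_rpow_of_exponent_le h1 (by linarith)
    _ = (((k + 1 : ℕ) : ℝ) ^ 2)⁻¹ := by
        rw [sampleScale, Real.rpow_neg (by positivity), Nat.cast_pow, ← Real.rpow_natCast,
          ← Real.rpow_mul (by positivity), sampleExponent_eq]
        norm_num

lemma summable_inv_succ_sq : Summable fun k : ℕ => (((k + 1 : ℕ) : ℝ) ^ 2)⁻¹ :=
  (summable_nat_add_iff 1 (f := fun k : ℕ => ((k : ℝ) ^ 2)⁻¹)).2
    (Real.summable_nat_pow_inv.2 one_lt_two)

lemma exists_sampleScale_index : ∃ idx : ℕ → ℕ,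
    (∀ N, 1 ≤ N → sampleScale (idx N) ≤ N ∧ N < sampleScale (idx N + 1)) ∧
      Tendsto idx atTop atTop := by
  have hex : ∀ N : ℕ, ∃ k, N < sampleScale (k + 1) := fun N =>
    ⟨N, lt_of_lt_of_le N.lt_succ_self (strictMono_sampleScale.id_le (N + 1))⟩
  refine ⟨fun N => Nat.find (hex N), fun N hN => ⟨?_, Nat.find_spec (hex N)⟩, ?_⟩
  · simp only
    rcases h : Nat.find (hex N) with _ | k
    · simpa [sampleScale] using hN
    · exact not_lt.1 (Nat.find_min (hex N) (m := k) (by omega))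
  · refine tendsto_atTop.2 fun b => eventually_atTop.2 ⟨sampleScale b, fun N hN => ?_⟩
    refine (Nat.le_find_iff (hex N) b).2 fun k hk => not_lt.2 ?_
    exact (strictMono_sampleScale.monotone (by omega : k + 1 ≤ b)).trans hN

/-- The expected number of selections strictly before index `N`. -/
def expectedCount (p : ℕ → ℝ) (N : ℕ) : ℝ := ∑ n ∈ Finset.range N, p n

lemma expectedCount_mono {p : ℕ → ℝ} (hp0 : ∀ n, 0 ≤ p n) : Monotone (expectedCount p) :=
  fun _ _ h => Finset.sum_le_sum_of_subset_of_nonneg (Finset.range_mono h) fun _ _ _ => hp0 _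

/-- The running averages of a nonincreasing sequence are nonincreasing. -/
lemma mul_expectedCount_le {p : ℕ → ℝ} (hanti : Antitone p) {N N' : ℕ} (h : N ≤ N') :
    (N : ℝ) * expectedCount p N' ≤ N' * expectedCount p N := by
  obtain ⟨d, rfl⟩ := Nat.exists_eq_add_of_le h
  have e : expectedCount p (N + d) = expectedCount p N + ∑ n ∈ Finset.range d, p (N + n) :=
    Finset.sum_range_add _ _ _
  have h1 : ∑ n ∈ Finset.range d, p (N + n) ≤ d * p N := by
    refine (Finset.sum_le_sum fun n _ => hanti (Nat.le_add_right N n)).trans_eq ?_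
    simp
  have h2 : N * p N ≤ expectedCount p N := by
    calc N * p N = ∑ n ∈ Finset.range N, p N := by simp
      _ ≤ _ := Finset.sum_le_sum fun n hn => hanti (Finset.mem_range.1 hn).le
  have hN : (0 : ℝ) ≤ N := Nat.cast_nonneg _
  have hd : (0 : ℝ) ≤ d := Nat.cast_nonneg _
  rw [e]; push_cast
  nlinarith

section Powers

variable {a : ℝ} {p : ℕ → ℝ}

lemma antitone_of_rpow (ha : 0 < a) (hp : ∀ n, p n = ((n + 1 : ℕ) : ℝ) ^ (-a)) : Antitone p := by
  intro m n h
  rw [hp, hp]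
  exact Real.rpow_le_rpow_of_nonpos (by positivity) (by exact_mod_cast Nat.succ_le_succ h)
    (by linarith)

lemma rpow_le_expectedCount (ha : 0 < a) (hp : ∀ n, p n = ((n + 1 : ℕ) : ℝ) ^ (-a)) {N : ℕ}
    (hN : 1 ≤ N) : (N : ℝ) ^ (1 - a) ≤ expectedCount p N := by
  have hN' : (0 : ℝ) < N := by exact_mod_cast hN
  calc (N : ℝ) ^ (1 - a) = ∑ _n ∈ Finset.range N, (N : ℝ) ^ (-a) := by
        rw [Finset.sum_const, Finset.card_range, nsmul_eq_mul, sub_eq_add_neg,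
          Real.rpow_add hN', Real.rpow_one]
    _ ≤ _ := by
        refine Finset.sum_le_sum fun n hn => ?_
        rw [hp]
        exact Real.rpow_le_rpow_of_nonpos (by positivity)
          (by exact_mod_cast Finset.mem_range.1 hn) (by linarith)

lemma tendsto_expectedCount_atTop (ha : 0 < a) (ha1 : a < 1)
    (hp : ∀ n, p n = ((n + 1 : ℕ) : ℝ) ^ (-a)) : Tendsto (expectedCount p) atTop atTop := by
  refine tendsto_atTop_mono' atTop (eventually_atTop.2 ⟨1, fun N hN =>
    rpow_le_expectedCount ha hp hN⟩) ?_
  exact (tendsto_rpow_atTop (by linarith)).comp tendsto_natCast_atTop_atTop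

lemma tendsto_zero_of_rpow (ha : 0 < a) (hp : ∀ n, p n = ((n + 1 : ℕ) : ℝ) ^ (-a)) :
    Tendsto p atTop (nhds 0) := by
  have : p = (fun n : ℕ => (n : ℝ) ^ (-a)) ∘ fun n => n + 1 := by ext n; exact hp n
  rw [this]
  exact ((tendsto_rpow_neg_atTop ha).comp tendsto_natCast_atTop_atTop).comp (tendsto_add_atTop_nat 1)

end Powers

/-! ### Regular selection sequences -/

/-- The double van der Corput bound with parameters suited to the selection density `n ^ (-a)`. -/
noncomputable def tunedCorputBound (a : ℝ) (p : ℕ → ℝ) (x : ℕ → ℕ) (N : ℕ) : ℝ :=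
  doubleCorputBound (centered p x) (selectionCount x) N (firstShift a N) (secondShift a N)
    ((N : ℝ) ^ (1 - 2 * a - 1 / 112))

/-- The selections follow their expectation, and the double van der Corput bound is small, along
the sequence `sampleScale`. -/
structure IsRegularSelection (a : ℝ) (p : ℕ → ℝ) (x : ℕ → ℕ) : Prop where
  le_one : ∀ n, x n ≤ 1
  count : Tendsto (fun k => (selectionCount x (sampleScale k) : ℝ) /
    expectedCount p (sampleScale k)) atTop (nhds 1)
  corput : Tendsto (fun k => tunedCorputBound a p x (sampleScale k) /
    expectedCount p (sampleScale k) ^ 2) atTop (nhds 0)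

theorem ae_isRegularSelection {Ω : Type*} [MeasurableSpace Ω] {P : Measure Ω}
    [IsProbabilityMeasure P] {ξ : ℕ → Ω → ℕ} (hm : ∀ n, Measurable (ξ n))
    (h1 : ∀ n ω, ξ n ω ≤ 1) (hind : iIndepFun ξ P) {a : ℝ} (ha0 : 0 < a) (ha : a < 1 / 14)
    {p : ℕ → ℝ} (hpa : ∀ n, p n = ((n + 1 : ℕ) : ℝ) ^ (-a))
    (hp : ∀ n, ∫ ω, (ξ n ω : ℝ) ∂P = p n) :
    ∀ᵐ ω ∂P, IsRegularSelection a p fun n => ξ n ω := by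
  have hp0 : ∀ n, 0 ≤ p n := fun n => by rw [hpa]; positivity
  have hp1 : ∀ n, p n ≤ 1 := fun n => by
    have := antitone_of_rpow ha0 hpa (Nat.zero_le n)
    rw [hpa 0] at this; simpa using this
  have hWpos : ∀ k, 0 < expectedCount p (sampleScale k) := fun k =>
    lt_of_lt_of_le (Real.rpow_pos_of_pos (by exact_mod_cast one_le_sampleScale k) _)
      (rpow_le_expectedCount ha0 hpa (one_le_sampleScale k))
  -- Chebyshev in summable form: the variance is at most `W`, so the normalized second moment is at
  -- most `1 / W`.
  have hcount : ∀ᵐ ω ∂P, Tendsto (fun k => ((selectionCount (fun n => ξ n ω) (sampleScale k) : ℝ) -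
      expectedCount p (sampleScale k)) ^ 2 / expectedCount p (sampleScale k) ^ 2)
      atTop (nhds 0) := by
    refine ae_tendsto_zero_of_integral_le (fun k => ?_) (fun k ω => by positivity)
      summable_inv_succ_sq fun k => ?_
    · refine (integrable_of_dependsOn hm h1 (M := sampleScale k)
        (Φ := fun x => ((selectionCount x (sampleScale k) : ℝ) -
          expectedCount p (sampleScale k)) ^ 2) fun x y hxy => ?_).div_const _
      have := dependsOn_selectionCount le_rfl hxy
      simp only at this
      simp only [this]
    · rw [integral_div]
      have h2 := integral_selectionCount_sub_sq_le hm h1 hind hp (sampleScale k)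
      have hW := rpow_le_expectedCount ha0 hpa (one_le_sampleScale k)
      have hn : (0 : ℝ) < sampleScale k := by exact_mod_cast one_le_sampleScale k
      calc _ ≤ expectedCount p (sampleScale k) / expectedCount p (sampleScale k) ^ 2 :=
            div_le_div_of_nonneg_right h2 (by positivity)
        _ = (expectedCount p (sampleScale k))⁻¹ := by
            have := (hWpos k).ne'
            field_simp
        _ ≤ ((sampleScale k : ℝ) ^ (1 - a))⁻¹ := inv_anti₀ (by positivity) hW
        _ = (sampleScale k : ℝ) ^ (-(1 - a)) := by rw [Real.rpow_neg hn.le]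
        _ ≤ _ := sampleScale_rpow_neg_le k (by linarith)
  have hcorput : ∀ᵐ ω ∂P, Tendsto (fun k => tunedCorputBound a p (fun n => ξ n ω) (sampleScale k) /
      expectedCount p (sampleScale k) ^ 2) atTop (nhds 0) := by
    refine ae_tendsto_zero_of_integral_le (fun k => ?_) (fun k ω => ?_)
      (summable_inv_succ_sq.mul_left 44) fun k => ?_
    · exact (integrable_of_dependsOn hm h1 (dependsOn_doubleCorputBound p _ _ _ _)).div_const _
    · have hn : (0 : ℝ) < sampleScale k := by exact_mod_cast one_le_sampleScale k
      exact div_nonneg (doubleCorputBound_nonneg _ _ _ _ _ (by positivity)) (by positivity)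
    · rw [integral_div, div_le_iff₀ (by have := hWpos k; positivity)]
      have hN := one_le_sampleScale k
      have hn : (0 : ℝ) < sampleScale k := by exact_mod_cast hN
      obtain ⟨R0, R1, -, -⟩ := ceil_rpow_bounds hN (e := a + 1 / 112) (by linarith) (by linarith)
      obtain ⟨S0, S1, -, -⟩ := ceil_rpow_bounds hN (e := 3 * a + 1 / 56) (by linarith) (by linarith)
      have h2 := integral_doubleCorputBound_le hm h1 hind hp hp0 hp1 R0 S0 R1 S1
        (l := (sampleScale k : ℝ) ^ (1 - 2 * a - 1 / 112))
        (κ := (sampleScale k : ℝ) ^ (1 / 2 - 5 / 2 * a - 1 / 56)) (by positivity) (by positivity)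
      refine h2.trans ((corput_parameters_bound ha0 ha hN
        (rpow_le_expectedCount ha0 hpa hN) rfl rfl).trans ?_)
      have := sampleScale_rpow_neg_le k (le_refl (1 / 112 : ℝ))
      gcongr
  filter_upwards [hcount, hcorput] with ω hc hd
  refine ⟨fun n => h1 n ω, ?_, hd⟩
  have h2 := hc.sqrt
  rw [Real.sqrt_zero] at h2
  have h3 := (tendsto_zero_iff_abs_tendsto_zero (fun k =>
    ((selectionCount (fun n => ξ n ω) (sampleScale k) : ℝ) - expectedCount p (sampleScale k)) /
      expectedCount p (sampleScale k))).2 (h2.congr fun k => by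
        rw [← div_pow, Real.sqrt_sq_eq_abs]; rfl)
  have h4 := h3.add_const 1
  rw [zero_add] at h4
  refine h4.congr fun k => ?_
  have := (hWpos k).ne'
  field_simp
  ring

lemma selectionCount_succ (x : ℕ → ℕ) (n : ℕ) :
    selectionCount x (n + 1) = selectionCount x n + x n := Finset.sum_range_succ _ _

lemma selectionCount_mono (x : ℕ → ℕ) : Monotone (selectionCount x) :=
  monotone_nat_of_le_succ fun n => by rw [selectionCount_succ]; omega

namespace IsRegularSelection

variable {a : ℝ} {p : ℕ → ℝ} {x : ℕ → ℕ}

lemma expectedCount_pos (hpa : ∀ n, p n = ((n + 1 : ℕ) : ℝ) ^ (-a)) {N : ℕ} (hN : 1 ≤ N) :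
    0 < expectedCount p N :=
  Finset.sum_pos (fun n _ => by rw [hpa]; positivity) (Finset.nonempty_range_iff.2 (by omega))

/-- Because the scale grows only polynomially, consecutive sampling points have ratio tending to
`1`, and the expected counts inherit this. It is what allows interpolation between sampling points.
-/
lemma tendsto_expectedCount_ratio (ha0 : 0 < a) (hpa : ∀ n, p n = ((n + 1 : ℕ) : ℝ) ^ (-a)) :
    Tendsto (fun k => expectedCount p (sampleScale (k + 1)) / expectedCount p (sampleScale k))
      atTop (nhds 1) := by
  have hp0 : ∀ n, 0 ≤ p n := fun n => by rw [hpa]; positivity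
  have hpos : ∀ k, 0 < expectedCount p (sampleScale k) := fun k =>
    expectedCount_pos hpa (one_le_sampleScale k)
  have hup : Tendsto (fun k : ℕ => (1 + 1 / ((k : ℝ) + 1)) ^ sampleExponent) atTop (nhds 1) := by
    have := ((tendsto_one_div_add_atTop_nhds_zero_nat (𝕜 := ℝ)).const_add 1).pow sampleExponent
    simpa using this
  refine tendsto_of_tendsto_of_tendsto_of_le_of_le tendsto_const_nhds hup (fun k => ?_) fun k => ?_
  · change 1 ≤ expectedCount p (sampleScale (k + 1)) / expectedCount p (sampleScale k)
    rw [one_le_div (hpos k)]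
    exact expectedCount_mono hp0 (sampleScale_lt_succ k).le
  · have h := mul_expectedCount_le (antitone_of_rpow ha0 hpa) (sampleScale_lt_succ k).le
    change expectedCount p (sampleScale (k + 1)) / expectedCount p (sampleScale k) ≤ _
    rw [div_le_iff₀ (hpos k)]
    have hn : (0 : ℝ) < sampleScale k := by exact_mod_cast one_le_sampleScale k
    have e : (sampleScale (k + 1) : ℝ) = sampleScale k * (1 + 1 / ((k : ℝ) + 1)) ^ sampleExponent := by
      simp only [sampleScale]
      push_cast
      rw [← mul_pow]
      congr 1
      field_simp
    rw [e, mul_assoc] at h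
    exact le_of_mul_le_mul_left h hn

lemma tendsto_count_div (hx : IsRegularSelection a p x) (ha0 : 0 < a)
    (hpa : ∀ n, p n = ((n + 1 : ℕ) : ℝ) ^ (-a)) :
    Tendsto (fun N => (selectionCount x N : ℝ) / expectedCount p N) atTop (nhds 1) := by
  have hp0 : ∀ n, 0 ≤ p n := fun n => by rw [hpa]; positivity
  obtain ⟨idx, hidx, htop⟩ := exists_sampleScale_index
  have hratio := tendsto_expectedCount_ratio ha0 hpa
  have hup : Tendsto (fun k => (selectionCount x (sampleScale (k + 1)) : ℝ) /
      expectedCount p (sampleScale k)) atTop (nhds 1) := by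
    have := ((tendsto_add_atTop_iff_nat 1).2 hx.count).mul hratio
    rw [one_mul] at this
    refine this.congr fun k => ?_
    have h1 := (expectedCount_pos hpa (one_le_sampleScale (k + 1))).ne'
    field_simp
  have hlow : Tendsto (fun k => (selectionCount x (sampleScale k) : ℝ) /
      expectedCount p (sampleScale (k + 1))) atTop (nhds 1) := by
    have := hx.count.div hratio one_ne_zero
    rw [div_one] at this
    refine this.congr fun k => ?_
    have h1 := (expectedCount_pos hpa (one_le_sampleScale k)).ne'
    have h2 := (expectedCount_pos hpa (one_le_sampleScale (k + 1))).ne'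
    simp only [Pi.div_apply]
    field_simp
  refine tendsto_of_tendsto_of_tendsto_of_le_of_le' (hlow.comp htop) (hup.comp htop) ?_ ?_
  · filter_upwards [eventually_ge_atTop 1] with N hN
    obtain ⟨g1, g2⟩ := hidx N hN
    refine div_le_div₀ (Nat.cast_nonneg _) (by exact_mod_cast selectionCount_mono x g1)
      (expectedCount_pos hpa hN) (expectedCount_mono hp0 g2.le)
  · filter_upwards [eventually_ge_atTop 1] with N hN
    obtain ⟨g1, g2⟩ := hidx N hN
    refine div_le_div₀ (Nat.cast_nonneg _) (by exact_mod_cast selectionCount_mono x g2.le)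
      (expectedCount_pos hpa (one_le_sampleScale _)) (expectedCount_mono hp0 g1)

lemma tendsto_centered_correlation {G : Type*} [AddCommGroup G] [TopologicalSpace G]
    [DiscreteTopology G] (hx : IsRegularSelection a p x) (ha0 : 0 < a) (ha : a < 1 / 14)
    (hpa : ∀ n, p n = ((n + 1 : ℕ) : ℝ) ^ (-a)) (m : InvariantMean G) (v₁ v₂ : G)
    {f g h : G →ᵇ ℝ} (hf : ∀ x, |f x| ≤ 1) (hg : ∀ x, |g x| ≤ 1) (hh : ∀ x, |h x| ≤ 1) :
    Tendsto (fun N => (∑ n ∈ Finset.range N, centered p x n *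
      m (h * (shift (selectionCount x n • v₁) f * shift (n • v₂) g))) / expectedCount p N)
      atTop (nhds 0) := by
  have hp0 : ∀ n, 0 ≤ p n := fun n => by rw [hpa]; positivity
  have hp1 : ∀ n, p n ≤ 1 := fun n => by
    have := antitone_of_rpow ha0 hpa (Nat.zero_le n)
    rw [hpa 0] at this; simpa using this
  obtain ⟨idx, hidx, htop⟩ := exists_sampleScale_index
  have hratio := tendsto_expectedCount_ratio ha0 hpa
  have hWpos : ∀ k, 0 < expectedCount p (sampleScale k) := fun k =>
    expectedCount_pos hpa (one_le_sampleScale k)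
  set c : ℕ → ℝ := fun n => m (h * (shift (selectionCount x n • v₁) f * shift (n • v₂) g)) with hc
  have hcb : ∀ n, |c n| ≤ 1 := fun n => m.abs_le_of_abs_le fun y =>
    abs_mul_le_one (hh y) (abs_mul_le_one (hf _) (hg _))
  set D : ℕ → ℝ := fun N => ∑ n ∈ Finset.range N, centered p x n * c n with hD
  have hstep : ∀ n, selectionCount x n ≤ selectionCount x (n + 1) ∧
      selectionCount x (n + 1) ≤ selectionCount x n + 1 := fun n => by
    have := hx.le_one n; rw [selectionCount_succ]; omega
  have hDk : ∀ k, |D (sampleScale k)| ≤ √(tunedCorputBound a p x (sampleScale k)) := fun k => by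
    have hN := one_le_sampleScale k
    have hn : (0 : ℝ) < sampleScale k := by exact_mod_cast hN
    obtain ⟨R0, -, -, -⟩ := ceil_rpow_bounds hN (e := a + 1 / 112) (by linarith) (by linarith)
    obtain ⟨S0, -, -, -⟩ := ceil_rpow_bounds hN (e := 3 * a + 1 / 56) (by linarith) (by linarith)
    exact Real.abs_le_sqrt (m.sq_sum_le_doubleCorputBound (abs_centered_le hp0 hp1 hx.le_one)
      hstep v₁ v₂ hf hg hh R0 S0 (by positivity))
  -- Between sampling points the sum moves by at most the number of selections plus its expectation,
  -- both negligible relative to `W`.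
  have hgap : ∀ N N', N ≤ N' → |D N' - D N| ≤
      ((selectionCount x N' : ℝ) - selectionCount x N) + (expectedCount p N' - expectedCount p N) := by
    intro N N' hle
    induction N', hle using Nat.le_induction with
    | base => simp
    | succ M hM ih =>
      have e : D (M + 1) - D N = (D M - D N) + centered p x M * c M := by
        simp only [hD, Finset.sum_range_succ]; ring
      have e2 : expectedCount p (M + 1) = expectedCount p M + p M := Finset.sum_range_succ _ _
      have hb : |centered p x M * c M| ≤ x M + p M := by
        rw [abs_mul]
        refine (mul_le_of_le_one_right (abs_nonneg _) (hcb M)).trans ?_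
        refine (abs_sub _ _).trans_eq ?_
        rw [abs_of_nonneg (Nat.cast_nonneg _), abs_of_nonneg (hp0 M)]
      rw [e, e2, selectionCount_succ]
      push_cast
      have := abs_add_le (D M - D N) (centered p x M * c M)
      linarith
  set U : ℕ → ℝ := fun k => √(tunedCorputBound a p x (sampleScale k) /
      expectedCount p (sampleScale k) ^ 2) +
    ((selectionCount x (sampleScale (k + 1)) : ℝ) / expectedCount p (sampleScale (k + 1)) *
      (expectedCount p (sampleScale (k + 1)) / expectedCount p (sampleScale k)) -
      (selectionCount x (sampleScale k) : ℝ) / expectedCount p (sampleScale k)) +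
    (expectedCount p (sampleScale (k + 1)) / expectedCount p (sampleScale k) - 1) with hU
  have hU0 : Tendsto U atTop (nhds 0) := by
    have := ((hx.corput.sqrt).add ((((tendsto_add_atTop_iff_nat 1).2 hx.count).mul hratio).sub
      hx.count)).add (hratio.sub_const 1)
    simpa using this
  refine squeeze_zero_norm' ?_ (hU0.comp htop)
  filter_upwards [eventually_ge_atTop 1] with N hN
  obtain ⟨g1, g2⟩ := hidx N hN
  have hW := hWpos (idx N)
  have hWN := expectedCount_mono hp0 g1
  rw [Real.norm_eq_abs, abs_div, abs_of_pos (hW.trans_le hWN)]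
  change |D N| / _ ≤ U (idx N)
  have q1 : |D N| ≤ √(tunedCorputBound a p x (sampleScale (idx N))) +
      (((selectionCount x (sampleScale (idx N + 1)) : ℝ) - selectionCount x (sampleScale (idx N))) +
      (expectedCount p (sampleScale (idx N + 1)) - expectedCount p (sampleScale (idx N)))) := by
    have h1 := hgap _ _ g1
    have h2 := abs_add_le (D (sampleScale (idx N))) (D N - D (sampleScale (idx N)))
    rw [add_sub_cancel] at h2
    have h3 := hDk (idx N)
    have h4 : (selectionCount x N : ℝ) ≤ selectionCount x (sampleScale (idx N + 1)) := by
      exact_mod_cast selectionCount_mono x g2.le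
    have h5 := expectedCount_mono hp0 g2.le
    linarith
  have q2 : |D N| / expectedCount p N ≤ |D N| / expectedCount p (sampleScale (idx N)) :=
    div_le_div_of_nonneg_left (abs_nonneg _) hW hWN
  refine q2.trans ((div_le_div_of_nonneg_right q1 hW.le).trans_eq ?_)
  have hW1 := (hWpos (idx N + 1)).ne'
  simp only [hU]
  rw [Real.sqrt_div' _ (by positivity), Real.sqrt_sq hW.le]
  field_simp
  ring

end IsRegularSelection

/-! ### Reduction to ergodic averages -/

namespace IsRegularSelection

variable {a : ℝ} {p : ℕ → ℝ} {x : ℕ → ℕ}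

lemma tendsto_selectionCount_atTop (hx : IsRegularSelection a p x) (ha0 : 0 < a) (ha1 : a < 1)
    (hpa : ∀ n, p n = ((n + 1 : ℕ) : ℝ) ^ (-a)) : Tendsto (selectionCount x) atTop atTop := by
  have h := (hx.tendsto_count_div ha0 hpa).pos_mul_atTop one_pos
    (tendsto_expectedCount_atTop ha0 ha1 hpa)
  have h2 : Tendsto (fun N => (selectionCount x N : ℝ)) atTop atTop := by
    refine h.congr' ?_
    filter_upwards [eventually_ge_atTop 1] with N hN
    exact div_mul_cancel₀ _ (expectedCount_pos hpa hN).ne'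
  exact tendsto_natCast_atTop_iff.1 h2

lemma tendsto_sum_mul_selection (hx : IsRegularSelection a p x) (ha0 : 0 < a) (ha1 : a < 1)
    (hpa : ∀ n, p n = ((n + 1 : ℕ) : ℝ) ^ (-a)) :
    Tendsto (fun N => (∑ n ∈ Finset.range N, p n * x n) / expectedCount p N) atTop (nhds 0) := by
  have e : ∀ N, ∑ n ∈ Finset.range N, (x n : ℝ) = selectionCount x N := fun N => by
    simp [selectionCount]
  have h1 : (fun n => p n * (x n : ℝ)) =o[atTop] fun n => (x n : ℝ) := by
    have := ((Asymptotics.isLittleO_one_iff ℝ).2 (tendsto_zero_of_rpow ha0 hpa)).mul_isBigO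
      (Asymptotics.isBigO_refl (fun n => (x n : ℝ)) atTop)
    simpa using this
  have h2 := h1.sum_range (fun n => Nat.cast_nonneg (x n)) (by
    simp only [e]
    exact tendsto_natCast_atTop_atTop.comp (hx.tendsto_selectionCount_atTop ha0 ha1 hpa))
  simp only [e] at h2
  have h3 := (h2.tendsto_div_nhds_zero).mul (hx.tendsto_count_div ha0 hpa)
  rw [zero_mul] at h3
  refine h3.congr' ?_
  filter_upwards [(hx.tendsto_selectionCount_atTop ha0 ha1 hpa).eventually_ge_atTop 1] with N hN
  exact div_mul_div_cancel₀ (by have : (0 : ℝ) < selectionCount x N := by exact_mod_cast hN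
                                exact this.ne')

/-- The summand telescopes up to two errors: the decrease of `p`, which sums to at most `p 0`, and
the change of `y`, which occurs only when `x n = 1` and costs `2 * p n * x n`. The latter is
negligible because `p` tends to `0`. -/
lemma tendsto_sum_sub_shift (hx : IsRegularSelection a p x) (ha0 : 0 < a) (ha1 : a < 1)
    (hpa : ∀ n, p n = ((n + 1 : ℕ) : ℝ) ^ (-a)) {c : ℕ → ℕ → ℝ} (hc : ∀ i j, |c i j| ≤ 1) :
    Tendsto (fun N => (∑ n ∈ Finset.range N, p n *
      (c (selectionCount x n) n - c (selectionCount x n) (n + 1))) / expectedCount p N)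
      atTop (nhds 0) := by
  have hp0 : ∀ n, 0 ≤ p n := fun n => by rw [hpa]; positivity
  have hanti := antitone_of_rpow ha0 hpa
  have hterm : ∀ n, |p n * (c (selectionCount x n) n - c (selectionCount x n) (n + 1)) +
      (p (n + 1) * c (selectionCount x (n + 1)) (n + 1) - p n * c (selectionCount x n) n)| ≤
      (p n - p (n + 1)) + 2 * (p n * x n) := by
    intro n
    have e : p n * (c (selectionCount x n) n - c (selectionCount x n) (n + 1)) +
      (p (n + 1) * c (selectionCount x (n + 1)) (n + 1) - p n * c (selectionCount x n) n) =
      (p (n + 1) - p n) * c (selectionCount x (n + 1)) (n + 1) +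
      p n * (c (selectionCount x (n + 1)) (n + 1) - c (selectionCount x n) (n + 1)) := by ring
    rw [e]
    refine (abs_add_le _ _).trans (add_le_add ?_ ?_)
    · rw [abs_mul, abs_sub_comm, abs_of_nonneg (sub_nonneg.2 (hanti n.le_succ))]
      exact mul_le_of_le_one_right (sub_nonneg.2 (hanti n.le_succ)) (hc _ _)
    · rw [abs_mul, abs_of_nonneg (hp0 n), mul_left_comm]
      refine mul_le_mul_of_nonneg_left ?_ (hp0 n)
      have h1 := hx.le_one n
      rw [selectionCount_succ]
      interval_cases hxn : x n
      · simp
      · refine (abs_sub _ _).trans ?_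
        have := hc (selectionCount x n + 1) (n + 1)
        have := hc (selectionCount x n) (n + 1)
        push_cast; linarith
  have hbound : ∀ N, |∑ n ∈ Finset.range N, p n *
      (c (selectionCount x n) n - c (selectionCount x n) (n + 1))| ≤
      3 * p 0 + 2 * ∑ n ∈ Finset.range N, p n * x n := by
    intro N
    have h1 := (Finset.abs_sum_le_sum_abs _ _).trans
      (Finset.sum_le_sum (s := Finset.range N) fun n _ => hterm n)
    rw [Finset.sum_add_distrib,
      Finset.sum_range_sub (fun n => p n * c (selectionCount x n) n) N, Finset.sum_add_distrib,
      Finset.sum_range_sub', ← Finset.mul_sum] at h1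
    set T := ∑ n ∈ Finset.range N, p n *
      (c (selectionCount x n) n - c (selectionCount x n) (n + 1))
    have h2 : ∀ n, |p n * c (selectionCount x n) n| ≤ p n := fun n => by
      rw [abs_mul, abs_of_nonneg (hp0 n)]
      exact mul_le_of_le_one_right (hp0 n) (hc _ _)
    have h3 := abs_le.1 (h2 N)
    have h4 := abs_le.1 (h2 0)
    have h5 := abs_le.1 h1
    have h6 := hanti (Nat.zero_le N)
    have h7 := hp0 N
    exact abs_le.2 ⟨by linarith [h5.1], by linarith [h5.2]⟩
  have hW := tendsto_expectedCount_atTop ha0 ha1 hpa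
  have hlim : Tendsto (fun N => 3 * p 0 / expectedCount p N +
      2 * ((∑ n ∈ Finset.range N, p n * x n) / expectedCount p N)) atTop (nhds 0) := by
    have := (hW.const_div_atTop (3 * p 0)).add
      ((hx.tendsto_sum_mul_selection ha0 ha1 hpa).const_mul 2)
    simpa using this
  refine squeeze_zero_norm' ?_ hlim
  filter_upwards [eventually_ge_atTop 1] with N hN
  have hpos := expectedCount_pos hpa hN
  rw [Real.norm_eq_abs, abs_div, abs_of_pos hpos, ← mul_div_assoc, ← add_div]
  exact div_le_div_of_nonneg_right (hbound N) hpos.le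

variable {G : Type*} [AddCommGroup G] [TopologicalSpace G] [DiscreteTopology G]

lemma tendsto_sum_sub_shift_smul (hx : IsRegularSelection a p x) (ha0 : 0 < a) (ha1 : a < 1)
    (hpa : ∀ n, p n = ((n + 1 : ℕ) : ℝ) ^ (-a)) (m : InvariantMean G) (v₁ v₂ : G)
    {f g h : G →ᵇ ℝ} (hf : ∀ x, |f x| ≤ 1) (hg : ∀ x, |g x| ≤ 1) (hh : ∀ x, |h x| ≤ 1) (j : ℕ) :
    Tendsto (fun N => (∑ n ∈ Finset.range N, p n *
      (m (h * (shift (selectionCount x n • v₁) f * shift (n • v₂) g)) -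
        m (h * (shift (selectionCount x n • v₁) f * shift (n • v₂) (shift (j • v₂) g))))) /
      expectedCount p N) atTop (nhds 0) := by
  induction j with
  | zero => simp
  | succ j ih =>
    have h1 := hx.tendsto_sum_sub_shift ha0 ha1 hpa
      (c := fun i n => m (h * (shift (i • v₁) f * shift (n • v₂) (shift (j • v₂) g))))
      (fun i n => m.abs_le_of_abs_le fun y =>
        abs_mul_le_one (hh y) (abs_mul_le_one (hf _) (hg _)))
    have h2 := ih.add h1
    rw [zero_add] at h2
    refine h2.congr fun N => ?_
    rw [← add_div, ← Finset.sum_add_distrib]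
    congr 1
    refine Finset.sum_congr rfl fun n _ => ?_
    have e : shift ((n + 1) • v₂) (shift (j • v₂) g) = shift (n • v₂) (shift ((j + 1) • v₂) g) := by
      rw [shift_shift, shift_shift]
      congr 1
      rw [← add_smul, ← add_smul]; congr 1; omega
    simp only [e]
    ring

lemma tendsto_sum_sub_shiftAvg (hx : IsRegularSelection a p x) (ha0 : 0 < a) (ha1 : a < 1)
    (hpa : ∀ n, p n = ((n + 1 : ℕ) : ℝ) ^ (-a)) (m : InvariantMean G) (v₁ v₂ : G)
    {f g h : G →ᵇ ℝ} (hf : ∀ x, |f x| ≤ 1) (hg : ∀ x, |g x| ≤ 1) (hh : ∀ x, |h x| ≤ 1) {K : ℕ}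
    (hK : 0 < K) :
    Tendsto (fun N => (∑ n ∈ Finset.range N, p n *
      (m (h * (shift (selectionCount x n • v₁) f * shift (n • v₂) g)) -
        m (h * (shift (selectionCount x n • v₁) f * shift (n • v₂) (shiftAvg K v₂ g))))) /
      expectedCount p N) atTop (nhds 0) := by
  have h1 := (tendsto_finsetSum (Finset.range K) fun j _ =>
    hx.tendsto_sum_sub_shift_smul ha0 ha1 hpa m v₁ v₂ hf hg hh j).const_mul (K : ℝ)⁻¹
  simp only [Finset.sum_const_zero, mul_zero] at h1
  refine h1.congr fun N => ?_
  have hK' : (K : ℝ) ≠ 0 := by positivity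
  rw [← Finset.sum_div, ← mul_div_assoc]
  congr 1
  rw [Finset.sum_comm, Finset.mul_sum]
  refine Finset.sum_congr rfl fun n _ => ?_
  have e : m (h * (shift (selectionCount x n • v₁) f * shift (n • v₂) (shiftAvg K v₂ g))) =
      (K : ℝ)⁻¹ * ∑ j ∈ Finset.range K,
        m (h * (shift (selectionCount x n • v₁) f * shift (n • v₂) (shift (j • v₂) g))) := by
    rw [shiftAvg, shift_smul, shift_sum, mul_smul_comm, mul_smul_comm, map_smul, Finset.mul_sum,
      Finset.mul_sum, map_sum, smul_eq_mul]
  rw [e, ← Finset.mul_sum, Finset.sum_sub_distrib, Finset.sum_const, Finset.card_range,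
    nsmul_eq_mul]
  field_simp

/-- The count takes each value below its final one at exactly one selected index. -/
lemma sum_selection_mul {φ : ℕ → ℝ} (h1 : ∀ n, x n ≤ 1) (N : ℕ) :
    ∑ n ∈ Finset.range N, (x n : ℝ) * φ (selectionCount x n) =
      ∑ i ∈ Finset.range (selectionCount x N), φ i := by
  induction N with
  | zero => simp [selectionCount]
  | succ N ih =>
    rw [Finset.sum_range_succ, ih, selectionCount_succ]
    have := h1 N
    interval_cases x N
    · simp
    · rw [Finset.sum_range_succ]; simp

/-- Correlations along the selected indices converge to correlations with ergodic averages. -/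
theorem eventually_abs_sum_sub_le (hx : IsRegularSelection a p x) (ha0 : 0 < a) (ha : a < 1 / 14)
    (hpa : ∀ n, p n = ((n + 1 : ℕ) : ℝ) ^ (-a)) (m : InvariantMean G) (v₁ v₂ : G)
    {f g h : G →ᵇ ℝ} (hf : ∀ x, |f x| ≤ 1) (hg : ∀ x, |g x| ≤ 1) (hh : ∀ x, |h x| ≤ 1)
    {ε : ℝ} (hε : 0 < ε) :
    ∃ H₀ : ℕ, ∀ L ≥ H₀, ∀ K ≥ H₀, ∀ᶠ N in atTop,
      |∑ n ∈ Finset.range N, (x n : ℝ) *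
          m (h * (shift (selectionCount x n • v₁) f * shift (n • v₂) g)) -
        selectionCount x N * m (h * (shiftAvg L v₁ f * shiftAvg K v₂ g))| ≤
      ε * selectionCount x N := by
  have ha1 : a < 1 := by linarith
  have hp0 : ∀ n, 0 ≤ p n := fun n => by rw [hpa]; positivity
  obtain ⟨H₁, hH₁, h₁⟩ := m.abs_mul_shiftAvg_sub_le v₁ f (by positivity : 0 < ε / 8)
  obtain ⟨H₂, hH₂, h₂⟩ := m.abs_mul_shiftAvg_sub_le v₂ g (by positivity : 0 < ε / 8)
  refine ⟨max H₁ H₂, fun L hL K hK => ?_⟩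
  have hL1 : H₁ ≤ L := (le_max_left _ _).trans hL
  have hK2 : H₂ ≤ K := (le_max_right _ _).trans hK
  have hhA : ∀ y, |(h * shiftAvg K v₂ g) y| ≤ 1 := fun y =>
    abs_mul_le_one (hh y) (abs_shiftAvg_le zero_le_one hg y)
  have t1 := hx.tendsto_centered_correlation ha0 ha hpa m v₁ v₂ hf hg hh
  have t2 := hx.tendsto_sum_sub_shiftAvg ha0 ha1 hpa m v₁ v₂ hf hg hh (hH₂.trans_le hK2)
  -- Once `g` is replaced by its nearly invariant average, that average is absorbed into `h`. The
  -- same estimate with `g = 1` then passes back from the weights `p` to `x`.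
  have t4 := hx.tendsto_centered_correlation ha0 ha hpa m v₁ v₂ (g := 1) hf (by simp) hhA
  have tc := hx.tendsto_count_div ha0 hpa
  have hs : (0 : ℝ) < ε / 16 := by positivity
  have b1 := (tendsto_zero_iff_abs_tendsto_zero _).1 t1 |>.eventually_lt_const hs
  have b2 := (tendsto_zero_iff_abs_tendsto_zero _).1 t2 |>.eventually_lt_const hs
  have b4 := (tendsto_zero_iff_abs_tendsto_zero _).1 t4 |>.eventually_lt_const hs
  have bc := tc.eventually_const_lt (by norm_num : (1 / 2 : ℝ) < 1)
  filter_upwards [b1, b2, b4, bc, eventually_ge_atTop 1,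
    (hx.tendsto_selectionCount_atTop ha0 ha1 hpa).eventually_ge_atTop H₁] with N b1 b2 b4 bc hN hyN
  have hW := expectedCount_pos hpa hN
  simp only [Function.comp_apply, abs_div, abs_of_pos hW] at b1 b2 b4
  rw [div_lt_iff₀ hW] at b1 b2 b4
  rw [lt_div_iff₀ hW] at bc
  set W := expectedCount p N with hWdef
  set y := selectionCount x with hy
  set B := shiftAvg K v₂ g with hB
  have s3 : |∑ n ∈ Finset.range N, p n * (m (h * (shift (y n • v₁) f * shift (n • v₂) B)) -
      m (h * B * (shift (y n • v₁) f * shift (n • v₂) 1)))| ≤ ε / 8 * W := by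
    have : ε / 8 * W = ∑ n ∈ Finset.range N, p n * (ε / 8) := by
      rw [← Finset.sum_mul, mul_comm]; rfl
    rw [this]
    refine (Finset.abs_sum_le_sum_abs _ _).trans (Finset.sum_le_sum fun n _ => ?_)
    rw [abs_mul, abs_of_nonneg (hp0 n)]
    refine mul_le_mul_of_nonneg_left ?_ (hp0 n)
    have := h₂ K hK2 K hK2 n (h * shift (y n • v₁) f) fun y => abs_mul_le_one (hh y) (hf _)
    have e1 : h * (shift (y n • v₁) f * shift (n • v₂) B) =
        h * shift (y n • v₁) f * shift (n • v₂) B := by ring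
    have e2 : h * B * (shift (y n • v₁) f * shift (n • v₂) 1) = h * shift (y n • v₁) f * B := by
      have : shift (n • v₂) (1 : G →ᵇ ℝ) = 1 := rfl
      rw [this]; ring
    rw [e1, e2]
    exact this
  have s5 : ∑ n ∈ Finset.range N, (x n : ℝ) *
      m (h * B * (shift (y n • v₁) f * shift (n • v₂) 1)) =
      y N * m (h * B * shiftAvg (y N) v₁ f) := by
    have e : ∀ n, h * B * (shift (y n • v₁) f * shift (n • v₂) (1 : G →ᵇ ℝ)) =
        h * B * shift (y n • v₁) f := fun n => by
      have : shift (n • v₂) (1 : G →ᵇ ℝ) = 1 := rfl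
      rw [this, mul_one]
    simp only [e]
    rw [sum_selection_mul (φ := fun i => m (h * B * shift (i • v₁) f)) hx.le_one N]
    have hy0 : ((y N : ℕ) : ℝ) ≠ 0 := by
      have : 0 < y N := by omega
      positivity
    rw [shiftAvg, mul_smul_comm, map_smul, smul_eq_mul, mul_inv_cancel_left₀ hy0, Finset.mul_sum,
      map_sum]
  have s6 : |m (h * B * shiftAvg (y N) v₁ f) - m (h * (shiftAvg L v₁ f * B))| ≤ ε / 8 := by
    have := h₁ (y N) hyN L hL1 0 (h * B) hhA
    rw [zero_smul, shift_zero] at this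
    have e : h * (shiftAvg L v₁ f * B) = h * B * shiftAvg L v₁ f := by ring
    rw [e]; exact this
  have hcen : ∀ F : ℕ → ℝ, ∑ n ∈ Finset.range N, centered p x n * F n =
      ∑ n ∈ Finset.range N, (x n : ℝ) * F n - ∑ n ∈ Finset.range N, p n * F n := fun F => by
    rw [← Finset.sum_sub_distrib]
    exact Finset.sum_congr rfl fun n _ => by rw [centered, sub_mul]
  simp only [mul_sub, Finset.sum_sub_distrib] at b2 s3
  rw [hcen] at b1 b4
  rw [s5] at b4
  have s7 : |(y N : ℝ) * m (h * B * shiftAvg (y N) v₁ f) -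
      y N * m (h * (shiftAvg L v₁ f * B))| ≤ y N * (ε / 8) := by
    rw [← mul_sub, abs_mul, abs_of_nonneg (Nat.cast_nonneg _)]
    exact mul_le_mul_of_nonneg_left s6 (Nat.cast_nonneg _)
  -- The errors relative to `W` total `5ε/16`, hence at most `5ε/8` relative to `y N`; the last step
  -- adds `ε/8`.
  have hWy : ε * W ≤ ε * (2 * y N) := mul_le_mul_of_nonneg_left (by linarith) hε.le
  rw [abs_lt] at b1 b2 b4
  rw [abs_le] at s3 s7 ⊢
  constructor
  · linarith [b1.1, b2.1, b4.2, s3.1, s7.1]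
  · linarith [b1.2, b2.2, b4.1, s3.2, s7.2]

end IsRegularSelection

/-! ### Box averages and the correspondence principle -/

/-- The lattice square `[-N, N]²` as a finite set. -/
noncomputable def latticeBoxFinset (N : ℕ) : Finset (ℤ × ℤ) :=
  Finset.Icc (-(N : ℤ), -(N : ℤ)) ((N : ℤ), (N : ℤ))

lemma coe_latticeBoxFinset (N : ℕ) : (latticeBoxFinset N : Set (ℤ × ℤ)) = latticeBox N :=
  Finset.coe_Icc _ _

lemma mem_latticeBoxFinset {N : ℕ} {z : ℤ × ℤ} :
    z ∈ latticeBoxFinset N ↔ (-(N : ℤ) ≤ z.1 ∧ z.1 ≤ N) ∧ (-(N : ℤ) ≤ z.2 ∧ z.2 ≤ N) := by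
  simp only [latticeBoxFinset, Finset.mem_Icc, Prod.le_def]
  tauto

lemma card_latticeBoxFinset (N : ℕ) : (latticeBoxFinset N).card = (2 * N + 1) ^ 2 := by
  rw [latticeBoxFinset, ← Finset.Icc_product_Icc, Finset.card_product, Int.card_Icc, pow_two]
  congr 1 <;> omega

/-- The average of `f` over the lattice square `[-N, N]²`. -/
noncomputable def boxAvg (N : ℕ) (f : ℤ × ℤ →ᵇ ℝ) : ℝ :=
  (∑ z ∈ latticeBoxFinset N, f z) / (latticeBoxFinset N).card

lemma card_latticeBoxFinset_pos (N : ℕ) : (0 : ℝ) < (latticeBoxFinset N).card := by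
  rw [card_latticeBoxFinset]; positivity

lemma boxAvg_mem_Icc (N : ℕ) (f : ℤ × ℤ →ᵇ ℝ) : boxAvg N f ∈ Set.Icc (-‖f‖) ‖f‖ := by
  rw [Set.mem_Icc, ← abs_le, boxAvg, abs_div, abs_of_pos (card_latticeBoxFinset_pos N),
    div_le_iff₀ (card_latticeBoxFinset_pos N)]
  refine (Finset.abs_sum_le_sum_abs _ _).trans
    ((Finset.sum_le_sum fun z _ => f.norm_coe_le_norm z).trans_eq ?_)
  rw [Finset.sum_const, nsmul_eq_mul, mul_comm]

/-- The square and its translate both lie in a slightly larger square, and each misses the same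
number of its points. -/
lemma abs_boxAvg_shift_sub_le (w : ℤ × ℤ) (f : ℤ × ℤ →ᵇ ℝ) (N : ℕ) :
    |boxAvg N (shift w f) - boxAvg N f| ≤
      2 * ‖f‖ * (((latticeBoxFinset (N + (w.1.natAbs + w.2.natAbs))).card : ℝ) /
        (latticeBoxFinset N).card - 1) := by
  have hpos := card_latticeBoxFinset_pos N
  set k := w.1.natAbs + w.2.natAbs with hk
  set C := latticeBoxFinset (N + k) with hC
  set B' := (latticeBoxFinset N).map (addRightEmbedding w) with hB'
  have hsub : latticeBoxFinset N ⊆ C := fun z hz => by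
    rw [mem_latticeBoxFinset] at hz ⊢
    push_cast
    omega
  have hsub' : B' ⊆ C := fun z hz => by
    obtain ⟨u, hu, rfl⟩ := Finset.mem_map.1 hz
    rw [mem_latticeBoxFinset] at hu ⊢
    simp only [addRightEmbedding_apply, Prod.fst_add, Prod.snd_add]
    omega
  have hdiff : ∀ D ⊆ C, D.card = (latticeBoxFinset N).card →
      |∑ z ∈ C, f z - ∑ z ∈ D, f z| ≤ ‖f‖ * ((C.card : ℝ) - (latticeBoxFinset N).card) := by
    intro D hD hcard
    rw [← Finset.sum_sdiff hD, add_sub_cancel_right]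
    refine (Finset.abs_sum_le_sum_abs _ _).trans
      ((Finset.sum_le_sum fun z _ => f.norm_coe_le_norm z).trans_eq ?_)
    rw [Finset.sum_const, nsmul_eq_mul, mul_comm, Finset.card_sdiff_of_subset hD,
      Nat.cast_sub (Finset.card_le_card hD), hcard]
  have h1 := hdiff _ hsub rfl
  have h2 := hdiff _ hsub' (Finset.card_map _)
  have e : ∑ z ∈ B', f z = ∑ z ∈ latticeBoxFinset N, shift w f z := by
    rw [hB', Finset.sum_map]; rfl
  rw [e] at h2
  have h3 : |∑ z ∈ latticeBoxFinset N, shift w f z - ∑ z ∈ latticeBoxFinset N, f z| ≤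
      2 * ‖f‖ * ((C.card : ℝ) - (latticeBoxFinset N).card) := by
    rw [abs_le] at h1 h2 ⊢
    constructor <;> linarith [h1.1, h1.2, h2.1, h2.2]
  rw [boxAvg, boxAvg, ← sub_div, abs_div, abs_of_pos hpos, div_le_iff₀ hpos]
  refine h3.trans_eq ?_
  field_simp

lemma tendsto_boxAvg_shift_sub (w : ℤ × ℤ) (f : ℤ × ℤ →ᵇ ℝ) :
    Tendsto (fun N => boxAvg N (shift w f) - boxAvg N f) atTop (nhds 0) := by
  set k := w.1.natAbs + w.2.natAbs with hk
  have h1 : Tendsto (fun N : ℕ => ((latticeBoxFinset (N + k)).card : ℝ) /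
      (latticeBoxFinset N).card) atTop (nhds 1) := by
    have h2 : Tendsto (fun N : ℕ => (1 + (2 * k : ℝ) / (2 * N + 1)) ^ 2) atTop (nhds 1) := by
      have : Tendsto (fun N : ℕ => (2 * k : ℝ) / (2 * N + 1)) atTop (nhds 0) :=
        Tendsto.const_div_atTop (tendsto_atTop_add_const_right _ _
          (tendsto_natCast_atTop_atTop.const_mul_atTop two_pos)) _
      simpa using (this.const_add 1).pow 2
    refine h2.congr fun N => ?_
    rw [card_latticeBoxFinset, card_latticeBoxFinset]
    push_cast
    rw [← div_pow]
    congr 1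
    field_simp
    ring
  have h3 := (h1.sub_const 1).const_mul (2 * ‖f‖)
  rw [sub_self, mul_zero] at h3
  exact squeeze_zero_norm (fun N => abs_boxAvg_shift_sub_le w f N) h3

lemma exists_tendsto_boxAvg (U : Ultrafilter ℕ) (f : ℤ × ℤ →ᵇ ℝ) :
    ∃ l, Tendsto (fun N => boxAvg N f) U (nhds l) := by
  obtain ⟨l, -, hl⟩ := (isCompact_Icc (a := -‖f‖) (b := ‖f‖)).ultrafilter_le_nhds
    (U.map fun N => boxAvg N f) (by
      rw [le_principal_iff]
      exact Filter.mem_map.2 (Filter.univ_mem' fun N => boxAvg_mem_Icc N f))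
  exact ⟨l, hl⟩

/-- The limit of box averages along an ultrafilter at infinity. -/
noncomputable def ultraMean (U : Ultrafilter ℕ) (hU : (U : Filter ℕ) ≤ atTop) :
    InvariantMean (ℤ × ℤ) where
  toLin :=
    { toFun := fun f => (exists_tendsto_boxAvg U f).choose
      map_add' := fun f g => by
        refine tendsto_nhds_unique (exists_tendsto_boxAvg U (f + g)).choose_spec
          (((exists_tendsto_boxAvg U f).choose_spec.add
            (exists_tendsto_boxAvg U g).choose_spec).congr fun N => ?_)
        simp [boxAvg, Finset.sum_add_distrib, add_div]
      map_smul' := fun c f => by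
        refine tendsto_nhds_unique (exists_tendsto_boxAvg U (c • f)).choose_spec
          (((exists_tendsto_boxAvg U f).choose_spec.const_mul c).congr fun N => ?_)
        simp [boxAvg, ← Finset.mul_sum, mul_div_assoc] }
  nonneg f hf := ge_of_tendsto' (exists_tendsto_boxAvg U f).choose_spec fun N =>
    div_nonneg (Finset.sum_nonneg fun z _ => hf z) (Nat.cast_nonneg _)
  map_one := by
    refine tendsto_nhds_unique (exists_tendsto_boxAvg U 1).choose_spec
      (tendsto_const_nhds.congr fun N => ?_)
    simp only [boxAvg, BoundedContinuousFunction.coe_one, Pi.one_apply, Finset.sum_const,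
      nsmul_eq_mul, mul_one]
    rw [div_self (card_latticeBoxFinset_pos N).ne']
  invariant w f := by
    refine tendsto_nhds_unique (exists_tendsto_boxAvg U (shift w f)).choose_spec ?_
    have := ((tendsto_boxAvg_shift_sub w f).mono_left hU).add
      (exists_tendsto_boxAvg U f).choose_spec
    simpa using this

lemma tendsto_ultraMean (U : Ultrafilter ℕ) (hU : (U : Filter ℕ) ≤ atTop) (f : ℤ × ℤ →ᵇ ℝ) :
    Tendsto (fun N => boxAvg N f) U (nhds (ultraMean U hU f)) :=
  (exists_tendsto_boxAvg U f).choose_spec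

/-- The indicator function of a set of lattice points. -/
noncomputable def indicatorBCF (E : Set (ℤ × ℤ)) : ℤ × ℤ →ᵇ ℝ :=
  BoundedContinuousFunction.ofNormedAddCommGroupDiscrete (E.indicator 1) 1 fun z => by
    by_cases h : z ∈ E <;> simp [h]

lemma indicatorBCF_apply (E : Set (ℤ × ℤ)) (z : ℤ × ℤ) : indicatorBCF E z = E.indicator 1 z := rfl

lemma indicatorBCF_nonneg (E : Set (ℤ × ℤ)) (z : ℤ × ℤ) : 0 ≤ indicatorBCF E z :=
  Set.indicator_nonneg (fun _ _ => zero_le_one) z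

lemma indicatorBCF_le_one (E : Set (ℤ × ℤ)) (z : ℤ × ℤ) : indicatorBCF E z ≤ 1 :=
  Set.indicator_le_self' (fun _ _ => zero_le_one) z

lemma indicatorBCF_inter (E F : Set (ℤ × ℤ)) :
    indicatorBCF (E ∩ F) = indicatorBCF E * indicatorBCF F := by
  ext z
  simp only [indicatorBCF_apply, BoundedContinuousFunction.coe_mul, Pi.mul_apply,
    Set.inter_indicator_one]

lemma indicatorBCF_translateSub (E : Set (ℤ × ℤ)) (w : ℤ × ℤ) :
    indicatorBCF (translateSub E w) = shift w (indicatorBCF E) := rfl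

lemma boxAvg_indicatorBCF (E : Set (ℤ × ℤ)) (N : ℕ) :
    boxAvg N (indicatorBCF E) = ((E ∩ latticeBox N).ncard : ℝ) / ((latticeBox N).ncard : ℝ) := by
  classical
  rw [boxAvg, ← coe_latticeBoxFinset, Set.ncard_coe_finset]
  congr 1
  have e : E ∩ (latticeBoxFinset N : Set (ℤ × ℤ)) =
      (((latticeBoxFinset N).filter (· ∈ E) : Finset (ℤ × ℤ)) : Set (ℤ × ℤ)) := by
    ext z; simp [and_comm]
  rw [e, Set.ncard_coe_finset, Finset.card_filter]
  push_cast
  refine Finset.sum_congr rfl fun z _ => ?_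
  simp only [indicatorBCF_apply, Set.indicator_apply, Pi.one_apply]

lemma upperDensity_eq_limsup_boxAvg (E : Set (ℤ × ℤ)) :
    upperDensity E = limsup (fun N => boxAvg N (indicatorBCF E)) atTop := by
  simp only [upperDensity, boxAvg_indicatorBCF]

lemma boxAvg_indicatorBCF_mem_Icc (E : Set (ℤ × ℤ)) (N : ℕ) :
    boxAvg N (indicatorBCF E) ∈ Set.Icc (0 : ℝ) 1 := by
  refine ⟨div_nonneg (Finset.sum_nonneg fun z _ => indicatorBCF_nonneg E z) (Nat.cast_nonneg _), ?_⟩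
  rw [boxAvg, div_le_one (card_latticeBoxFinset_pos N)]
  refine (Finset.sum_le_sum fun z _ => indicatorBCF_le_one E z).trans_eq (by simp)

lemma isBoundedUnder_boxAvg_indicatorBCF (E : Set (ℤ × ℤ)) :
    IsBoundedUnder (· ≤ ·) atTop (fun N => boxAvg N (indicatorBCF E)) ∧
      IsBoundedUnder (· ≥ ·) atTop (fun N => boxAvg N (indicatorBCF E)) :=
  ⟨isBoundedUnder_of ⟨1, fun N => (boxAvg_indicatorBCF_mem_Icc E N).2⟩,
    isBoundedUnder_of ⟨0, fun N => (boxAvg_indicatorBCF_mem_Icc E N).1⟩⟩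

lemma upperDensity_le_one (E : Set (ℤ × ℤ)) : upperDensity E ≤ 1 := by
  rw [upperDensity_eq_limsup_boxAvg]
  exact limsup_le_of_le (isBoundedUnder_boxAvg_indicatorBCF E).2.isCoboundedUnder_le
    (Eventually.of_forall fun N => (boxAvg_indicatorBCF_mem_Icc E N).2)

lemma ultraMean_indicatorBCF_le (U : Ultrafilter ℕ) (hU : (U : Filter ℕ) ≤ atTop)
    (F : Set (ℤ × ℤ)) : ultraMean U hU (indicatorBCF F) ≤ upperDensity F := by
  rw [upperDensity_eq_limsup_boxAvg]
  refine le_of_forall_pos_le_add fun ε hε => ?_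
  refine le_of_tendsto (tendsto_ultraMean U hU _) (hU ?_)
  filter_upwards [eventually_lt_of_limsup_lt (lt_add_of_pos_right _ hε)
    (isBoundedUnder_boxAvg_indicatorBCF F).1] with N hN
  exact hN.le

/-- A finitary form of Furstenberg's correspondence principle. -/
theorem exists_mean_eq_upperDensity (E : Set (ℤ × ℤ)) : ∃ m : InvariantMean (ℤ × ℤ),
    m (indicatorBCF E) = upperDensity E ∧ ∀ F, m (indicatorBCF F) ≤ upperDensity F := by
  -- The limsup of a bounded sequence is a cluster point, hence a limit along some ultrafilter at
  -- infinity. For other sets the limit along that ultrafilter is at most the limsup.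
  have hcl : MapClusterPt (upperDensity E) atTop fun N => boxAvg N (indicatorBCF E) := by
    rw [mapClusterPt_iff_frequently]
    intro s hs
    obtain ⟨ε, hε, hball⟩ := Metric.mem_nhds_iff.1 hs
    obtain ⟨b1, b2⟩ := isBoundedUnder_boxAvg_indicatorBCF E
    rw [upperDensity_eq_limsup_boxAvg] at hball
    have h1 := frequently_lt_of_lt_limsup b2.isCoboundedUnder_le (sub_lt_self _ hε)
    have h2 := eventually_lt_of_limsup_lt (lt_add_of_pos_right _ hε) b1
    refine (h1.and_eventually h2).mono fun N hN => hball ?_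
    rw [Metric.mem_ball, Real.dist_eq, abs_lt]
    constructor <;> linarith [hN.1, hN.2]
  obtain ⟨U, hU, hlim⟩ := mapClusterPt_iff_ultrafilter.1 hcl
  exact ⟨ultraMean U hU, tendsto_nhds_unique (tendsto_ultraMean U hU _) hlim,
    ultraMean_indicatorBCF_le U hU⟩

/-! ### Selected indices and the deterministic lower bound -/

lemma exists_selectionCount_eq {x : ℕ → ℕ} (h1 : ∀ n, x n ≤ 1)
    (h : Tendsto (selectionCount x) atTop atTop) (N : ℕ) : ∃ M, selectionCount x M = N := by
  have hex : ∃ M, N ≤ selectionCount x M := (h.eventually_ge_atTop N).exists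
  refine ⟨Nat.find hex, le_antisymm ?_ (Nat.find_spec hex)⟩
  rcases hM : Nat.find hex with _ | M
  · simp [selectionCount]
  · have := Nat.find_min hex (m := M) (by omega)
    have := h1 M
    rw [selectionCount_succ]; omega

lemma selectionCount_le {x : ℕ → ℕ} (h1 : ∀ n, x n ≤ 1) (N : ℕ) : selectionCount x N ≤ N :=
  (Finset.sum_le_sum fun n _ => h1 n).trans_eq (by simp)

lemma sum_Icc_eq_selectionCount {x : ℕ → ℕ} {ζ : ℕ → ℝ} (hζ : ∀ n, ζ (n + 1) = x n) (k : ℕ) :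
    ∑ j ∈ Finset.Icc 1 k, ζ j = selectionCount x k := by
  induction k with
  | zero => simp [selectionCount]
  | succ k ih => rw [Finset.sum_Icc_succ_top (by omega), ih, hζ, selectionCount_succ]; push_cast; rfl

/-- The unit shift reflects that `ζ` starts at `1` and `x` at `0`. Monotonicity of the count shows
that no earlier index reaches this value. -/
lemma selectedIndex_selectionCount_succ {x : ℕ → ℕ} {ζ : ℕ → ℝ} (hζ : ∀ n, ζ (n + 1) = x n) {k : ℕ}
    (hk : x k = 1) : selectedIndex ζ (selectionCount x k + 1) = k + 1 := by
  have e : {j : ℕ | ∑ i ∈ Finset.Icc 1 j, ζ i = ((selectionCount x k + 1 : ℕ) : ℝ)} =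
      {j | selectionCount x j = selectionCount x k + 1} := by
    ext j
    simp only [Set.mem_ofPred_eq, sum_Icc_eq_selectionCount hζ, Nat.cast_inj]
  rw [selectedIndex, e]
  have hmem : k + 1 ∈ {j | selectionCount x j = selectionCount x k + 1} := by
    simp [selectionCount_succ, hk]
  refine le_antisymm (Nat.sInf_le hmem) (le_csInf ⟨_, hmem⟩ fun j hj => ?_)
  by_contra hlt
  have := selectionCount_mono x (show j ≤ k by omega)
  simp only [Set.mem_ofPred_eq] at hj
  omega

lemma sum_selectedIndex {x : ℕ → ℕ} (h1 : ∀ n, x n ≤ 1) {ζ : ℕ → ℝ} (hζ : ∀ n, ζ (n + 1) = x n)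
    (F : ℕ → ℕ → ℝ) (M : ℕ) :
    ∑ n ∈ Finset.Icc 1 (selectionCount x M), F n (selectedIndex ζ n) =
      ∑ k ∈ Finset.range M, (x k : ℝ) * F (selectionCount x k + 1) (k + 1) := by
  induction M with
  | zero => simp [selectionCount]
  | succ M ih =>
    rw [Finset.sum_range_succ, ← ih, selectionCount_succ]
    have := h1 M
    interval_cases hM : x M
    · simp
    · rw [Finset.sum_Icc_succ_top (by omega), selectedIndex_selectionCount_succ hζ hM]; simp

/-- The lower bound for a single regular selection sequence. -/
theorem IsRegularSelection.cube_le_liminf {a : ℝ} {p : ℕ → ℝ} {x : ℕ → ℕ}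
    (hx : IsRegularSelection a p x) (ha0 : 0 < a) (ha : a < 1 / 14)
    (hpa : ∀ n, p n = ((n + 1 : ℕ) : ℝ) ^ (-a)) {ζ : ℕ → ℝ} (hζ : ∀ n, ζ (n + 1) = x n)
    (v₁ v₂ : ℤ × ℤ) (E : Set (ℤ × ℤ)) :
    upperDensity E ^ 3 ≤ liminf (fun N : ℕ => (1 / (N : ℝ)) * ∑ n ∈ Finset.Icc 1 N,
      upperDensity (E ∩ translateSub E (n • v₁) ∩ translateSub E (selectedIndex ζ n • v₂)))
      atTop := by
  obtain ⟨m, hmE, hm⟩ := exists_mean_eq_upperDensity E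
  set f := indicatorBCF E with hf
  have hf0 := indicatorBCF_nonneg E
  have hf1 := indicatorBCF_le_one E
  have hfa : ∀ z, |f z| ≤ 1 := fun z => abs_le.2 ⟨by linarith [hf0 z], hf1 z⟩
  have hgrow := hx.tendsto_selectionCount_atTop ha0 (by linarith) hpa
  have hcob : IsCoboundedUnder (· ≥ ·) atTop (fun N : ℕ => (1 / (N : ℝ)) *
      ∑ n ∈ Finset.Icc 1 N, upperDensity (E ∩ translateSub E (n • v₁) ∩
        translateSub E (selectedIndex ζ n • v₂))) := by
    refine IsBoundedUnder.isCoboundedUnder_ge (isBoundedUnder_of ⟨1, fun N => ?_⟩)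
    rw [one_div_mul_eq_div]
    refine div_le_one_of_le₀ ?_ (Nat.cast_nonneg N)
    exact (Finset.sum_le_sum fun n _ => upperDensity_le_one _).trans_eq (by simp)
  refine le_of_forall_pos_sub_le fun ε hε => le_liminf_of_le hcob ?_
  obtain ⟨H₁, h₁⟩ := m.cube_sub_le v₁ v₂ hf0 hf1 (by positivity : 0 < ε / 4)
  -- The functions are pretranslated by `v₁` and `v₂` because the selected pairs are `(y k + 1, k +
  -- 1)`. The near-invariance of the averages removes these translations afterwards, at cost `ε / 4`
  -- each.
  obtain ⟨H₂, h₂⟩ := hx.eventually_abs_sum_sub_le ha0 ha hpa m v₁ v₂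
    (f := shift v₁ f) (g := shift v₂ f) (h := f) (fun z => hfa _) (fun z => hfa _) hfa
    (by positivity : 0 < ε / 4)
  obtain ⟨H₃, -, h₃⟩ := m.abs_mul_shiftAvg_sub_le v₁ f (by positivity : 0 < ε / 4)
  obtain ⟨H₄, -, h₄⟩ := m.abs_mul_shiftAvg_sub_le v₂ f (by positivity : 0 < ε / 4)
  set H := max (max H₁ H₂) (max H₃ H₄) with hH
  have hH1 : H₁ ≤ H := (le_max_left _ _).trans (le_max_left _ _)
  have hH2 : H₂ ≤ H := (le_max_right _ _).trans (le_max_left _ _)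
  have hH3 : H₃ ≤ H := (le_max_left _ _).trans (le_max_right _ _)
  have hH4 : H₄ ≤ H := (le_max_right _ _).trans (le_max_right _ _)
  have k1 := h₁ H hH1 H hH1
  have havg : ∀ v : ℤ × ℤ, shiftAvg H v (shift v f) = shift v (shiftAvg H v f) := fun v => by
    rw [shiftAvg, shiftAvg, shift_smul, shift_sum]
    simp only [shift_shift, add_comm]
  have k3 := h₃ H hH3 H hH3 1 (f * shift v₂ (shiftAvg H v₂ f)) fun z =>
    abs_mul_le_one (hfa z) (abs_shiftAvg_le zero_le_one hfa _)
  have k4 := h₄ H hH4 H hH4 1 (f * shiftAvg H v₁ f) fun z =>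
    abs_mul_le_one (hfa z) (abs_shiftAvg_le zero_le_one hfa _)
  rw [one_smul] at k3 k4
  have k5 : m f ^ 3 - 3 * (ε / 4) ≤
      m (f * (shiftAvg H v₁ (shift v₁ f) * shiftAvg H v₂ (shift v₂ f))) := by
    rw [havg, havg]
    have e1 : f * (shift v₁ (shiftAvg H v₁ f) * shift v₂ (shiftAvg H v₂ f)) =
        f * shift v₂ (shiftAvg H v₂ f) * shift v₁ (shiftAvg H v₁ f) := by ring
    have e2 : f * shift v₂ (shiftAvg H v₂ f) * shiftAvg H v₁ f =
        f * shiftAvg H v₁ f * shift v₂ (shiftAvg H v₂ f) := by ring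
    have e3 : f * (shiftAvg H v₁ f * shiftAvg H v₂ f) =
        f * shiftAvg H v₁ f * shiftAvg H v₂ f := by ring
    rw [e2] at k3
    rw [e3] at k1
    rw [e1]
    linarith [(abs_le.1 k3).1, (abs_le.1 k4).1]
  obtain ⟨M₀, hM₀⟩ := eventually_atTop.1 (h₂ H hH2 H hH2)
  filter_upwards [eventually_ge_atTop M₀, eventually_ge_atTop 1] with N hN hN1
  -- The first `N` selected indices are those below `M`; since `M ≥ N`, the asymptotic estimate
  -- applies at `M`.
  obtain ⟨M, hM⟩ := exists_selectionCount_eq hx.le_one hgrow N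
  have hNM : N ≤ M := hM ▸ selectionCount_le hx.le_one M
  have hN0 : (0 : ℝ) < N := by exact_mod_cast hN1
  have key := (abs_le.1 (hM₀ M (hN.trans hNM))).1
  rw [hM] at key
  have hsum : ∑ k ∈ Finset.range M, (x k : ℝ) * m (f * (shift (selectionCount x k • v₁)
      (shift v₁ f) * shift (k • v₂) (shift v₂ f))) ≤ ∑ n ∈ Finset.Icc 1 N,
        upperDensity (E ∩ translateSub E (n • v₁) ∩ translateSub E (selectedIndex ζ n • v₂)) := by
    have e := sum_selectedIndex hx.le_one hζ
      (fun n k => m (f * (shift (n • v₁) f * shift (k • v₂) f))) M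
    rw [hM] at e
    have e2 : ∀ k, m (f * (shift (selectionCount x k • v₁) (shift v₁ f) *
        shift (k • v₂) (shift v₂ f))) = m (f * (shift ((selectionCount x k + 1) • v₁) f *
          shift ((k + 1) • v₂) f)) := fun k => by
      rw [shift_shift, shift_shift, add_smul, add_smul, one_smul, one_smul]
    simp only [e2]
    rw [← e]
    refine Finset.sum_le_sum fun n _ => ?_
    have := hm (E ∩ translateSub E (n • v₁) ∩ translateSub E (selectedIndex ζ n • v₂))
    rwa [indicatorBCF_inter, indicatorBCF_inter, indicatorBCF_translateSub,
      indicatorBCF_translateSub, mul_assoc] at this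
  rw [one_div_mul_eq_div, le_div_iff₀ hN0]
  rw [← hmE]
  have := mul_le_mul_of_nonneg_right k5 hN0.le
  linarith

/-! ### Transfer to the given random variables -/

section Probability

variable {Ω : Type*} [MeasurableSpace Ω]

/-- The selection indicators attached to a sequence of random variables. -/
noncomputable def selectionIndicator (X : ℕ → Ω → ℝ) (n : ℕ) : Ω → ℕ :=
  {ω | X (n + 1) ω = 1}.indicator 1

lemma selectionIndicator_le_one {Ω : Type*} (X : ℕ → Ω → ℝ) (n : ℕ) (ω : Ω) : selectionIndicator X n ω ≤ 1 :=
  Set.indicator_le_self' (fun _ _ => zero_le_one) ω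

lemma measurableSet_eq_one {X : ℕ → Ω → ℝ} (hX : ∀ n : ℕ, 1 ≤ n → Measurable (X n)) (n : ℕ) :
    MeasurableSet {ω | X (n + 1) ω = 1} :=
  hX (n + 1) (by omega) (measurableSet_singleton 1)

lemma iIndepFun_selectionIndicator {P : Measure Ω} {X : ℕ → Ω → ℝ}
    (hX : iIndepFun (fun n : ℕ+ => X (n : ℕ)) P) : iIndepFun (selectionIndicator X) P := by
  have h1 : iIndepFun (fun n : ℕ => X (n + 1)) P :=
    hX.precomp (g := Nat.succPNat) Nat.succPNat_injective
  have h2 := h1.comp (fun _ => ({1} : Set ℝ).indicator (1 : ℝ → ℕ))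
    fun _ => measurable_one.indicator (measurableSet_singleton 1)
  exact h2

lemma integral_selectionIndicator {P : Measure Ω} {X : ℕ → Ω → ℝ}
    (hX : ∀ n : ℕ, 1 ≤ n → Measurable (X n)) {n : ℕ} {q : ℝ} (hq : 0 ≤ q)
    (h : P {ω | X (n + 1) ω = 1} = ENNReal.ofReal q) :
    ∫ ω, (selectionIndicator X n ω : ℝ) ∂P = q := by
  have e : ∀ ω, (selectionIndicator X n ω : ℝ) = {ω | X (n + 1) ω = 1}.indicator 1 ω := fun ω => by
    by_cases hω : X (n + 1) ω = 1 <;> simp [selectionIndicator, hω]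
  simp only [e]
  rw [integral_indicator_one (measurableSet_eq_one hX n), measureReal_def, h,
    ENNReal.toReal_ofReal hq]

lemma ae_eq_one_or_eq_zero {P : Measure Ω} [IsProbabilityMeasure P] {Y : Ω → ℝ}
    (hY : Measurable Y) {q : ℝ} (hq0 : 0 ≤ q) (hq1 : q ≤ 1)
    (h1 : P {ω | Y ω = 1} = ENNReal.ofReal q) (h0 : P {ω | Y ω = 0} = ENNReal.ofReal (1 - q)) :
    ∀ᵐ ω ∂P, Y ω = 1 ∨ Y ω = 0 := by
  have hm0 : MeasurableSet {ω | Y ω = 0} := hY (measurableSet_singleton 0)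
  have hm1 : MeasurableSet {ω | Y ω = 1} := hY (measurableSet_singleton 1)
  have hdisj : Disjoint {ω | Y ω = 1} {ω | Y ω = 0} := by
    rw [Set.disjoint_left]
    intro ω h h'
    simp only [Set.mem_ofPred_eq] at h h'
    rw [h] at h'; exact one_ne_zero h'
  have hone : P ({ω | Y ω = 1} ∪ {ω | Y ω = 0}) = 1 := by
    rw [measure_union hdisj hm0, h1, h0, ← ENNReal.ofReal_add hq0 (by linarith)]
    simp
  exact (prob_compl_eq_zero_iff (hm1.union hm0)).2 hone

end Probability

theorem corollary1p3 {Ω : Type*} [MeasurableSpace Ω] (P : Measure Ω) [IsProbabilityMeasure P]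
    (a : ℝ) (ha : a ∈ Set.Ioo (0 : ℝ) (1 / 14))
    (X : ℕ → Ω → ℝ)
    (hX_meas : ∀ n : ℕ, 1 ≤ n → Measurable (X n))
    (hX_indep : iIndepFun (fun n : ℕ+ => X (n : ℕ)) P)
    (hX_one : ∀ n : ℕ, 1 ≤ n → P {ω | X n ω = 1} = ENNReal.ofReal ((n : ℝ) ^ (-a)))
    (hX_zero : ∀ n : ℕ, 1 ≤ n → P {ω | X n ω = 0} = ENNReal.ofReal (1 - (n : ℝ) ^ (-a))) :
    ∀ᵐ ω ∂P, ∀ (v₁ v₂ : ℤ × ℤ) (E : Set (ℤ × ℤ)),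
      upperDensity E ^ 3 ≤
        liminf (fun N : ℕ => (1 / (N : ℝ)) * ∑ n ∈ Finset.Icc 1 N,
          upperDensity (E ∩ translateSub E (n • v₁) ∩
            translateSub E (selectedIndex (fun j => X j ω) n • v₂))) atTop := by
  set p : ℕ → ℝ := fun n => ((n + 1 : ℕ) : ℝ) ^ (-a) with hp
  have hp0 : ∀ n, 0 ≤ p n := fun n => by rw [hp]; positivity
  have hp1 : ∀ n, p n ≤ 1 := fun n => by
    have := antitone_of_rpow ha.1 (p := p) (fun _ => rfl) (Nat.zero_le n)
    simpa [hp] using this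
  have hreg := ae_isRegularSelection (P := P) (ξ := selectionIndicator X) (p := p) (a := a)
    (fun n => measurable_one.indicator (measurableSet_eq_one hX_meas n))
    (selectionIndicator_le_one X) (iIndepFun_selectionIndicator hX_indep) ha.1 ha.2 (fun _ => rfl)
    (fun n => integral_selectionIndicator hX_meas (hp0 n) (hX_one (n + 1) (by omega)))
  -- The variables take values in `{0, 1}` only almost surely, while `selectionIndicator` does so
  -- everywhere; off a null set the two agree.
  have hval : ∀ᵐ ω ∂P, ∀ n : ℕ, X (n + 1) ω = 1 ∨ X (n + 1) ω = 0 := ae_all_iff.2 fun n =>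
    ae_eq_one_or_eq_zero (hX_meas (n + 1) (by omega)) (hp0 n) (hp1 n)
      (hX_one (n + 1) (by omega)) (hX_zero (n + 1) (by omega))
  filter_upwards [hreg, hval] with ω hω hv v₁ v₂ E
  refine hω.cube_le_liminf ha.1 ha.2 (fun _ => rfl) (fun n => ?_) v₁ v₂ E
  rcases hv n with h | h <;> simp [selectionIndicator, h]
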